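/- Let $A_0B_0C_0$ be a non-degenerate triangle in the Euclidean plane. Given the triangle $A_nB_nC_n$, choose points $A_{n+1}$, $B_{n+1}$, $C_{n+1}$ on its sides $B_nC_n$, $C_nA_n$, $A_nB_n$ respectively, uniformly distributed on these sides, independently of each other and of all earlier choices; that is, $$A_{n+1}=B_n+\xi^{(n)}_a(C_n-B_n),\quad B_{n+1}=C_n+\xi^{(n)}_b(A_n-C_n),\quad C_{n+1}=A_n+\xi^{(n)}_c(B_n-A_n),$$ where the variables $\xi^{(n)}_a,\xi^{(n)}_b,\xi^{(n)}_c$ ($n\ge 0$) are independent and uniformly distributed on $[0,1]$. Then almost surely all triangles $A_nB_nC_n$ are non-degenerate, and almost surely the largest angle of $A_nB_nC_n$ converges to $\pi$ as $n\to\infty$. Moreover, let $y_n$ be the ratio of the height of $A_nB_nC_n$ corresponding to its largest side to the length of this side. Then for every real $c<1+\frac{\log 4}{3}-\frac{\pi^2}{9}=0.365\dots$, almost surely $$y_n\le e^{-cn}\quad\text{for all sufficiently large } n.$$ -/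

import Mathlib

namespace RandomTriangle

/-- The Euclidean plane. -/
abbrev Plane : Type := EuclideanSpace ℝ (Fin 2)

/-- A (possibly degenerate) triangle, given by its three vertices `A = T 0`, `B = T 1`, `C = T 2`.
The side opposite to `T i` joins `T (i + 1)` and `T (i + 2)` (indices modulo 3). -/
abbrev Tri : Type := Fin 3 → Plane

/-- The length of the side opposite to the vertex `T i`. -/
noncomputable def side (T : Tri) (i : Fin 3) : ℝ :=
  dist (T (i + 1)) (T (i + 2))

/-- The height of the triangle from the vertex `T i`: the distance from this vertex to the line
through the other two vertices. -/
noncomputable def height (T : Tri) (i : Fin 3) : ℝ :=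
  Metric.infDist (T i) (affineSpan ℝ {T (i + 1), T (i + 2)} : Set Plane)

/-- The side opposite to `T i` is a largest side of the triangle. -/
def IsLargestSide (T : Tri) (i : Fin 3) : Prop :=
  ∀ j, side T j ≤ side T i

/-- The largest of the three angles of the triangle. -/
noncomputable def maxAngle (T : Tri) : ℝ :=
  ⨆ i : Fin 3, EuclideanGeometry.angle (T (i + 1)) (T i) (T (i + 2))

/-- The triangle whose `i`-th vertex lies on the side opposite to `T i` and divides it,
starting from `T (i + 1)`, in the proportion `t i : 1 - t i`. -/
noncomputable def subTriangle (T : Tri) (t : Fin 3 → ℝ) : Tri := fun i =>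
  AffineMap.lineMap (T (i + 1)) (T (i + 2)) (t i)

/-- The sequence of triangles that starts with `T₀`, where the `(n + 1)`-st triangle is inscribed in
the `n`-th one with the parameters `t n`. -/
noncomputable def triangleSeq (T₀ : Tri) (t : ℕ → Fin 3 → ℝ) : ℕ → Tri
  | 0 => T₀
  | n + 1 => subTriangle (triangleSeq T₀ t n) (t n)

end RandomTriangle

/-!
The area of the `n`-th triangle is the product of `n` independent factors, and the mean of the
logarithm of one factor is `π ^ 2 / 9 - 8 / 3`; by the strong law of large numbers the area is
`exp ((π ^ 2 / 9 - 8 / 3 + o(1)) * n)`. To show that the diameter does not decay too fast, project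
the vertices to a line in general position. Given its two extreme points, the middle one of the
three new projections is uniform between them, so the expectation of `spread ^ (-s)` can be
estimated from the density of the extremes: one step multiplies it by at most
`1 + (5 / 6 - log 2 / 3) * s + O(s ^ 2)`. With the same conditional uniformity, the
Borel–Cantelli argument applies to the product of the two gaps between the projections, which is
therefore at least `exp (-2 * (5 / 6 - log 2 / 3 + o(1)) * n)`. Both the ratio of the height to the
largest side and the defect `π - maxAngle` are at most a constant times area over product of gaps,
and the difference of the exponents is `-(1 + log 4 / 3 - π ^ 2 / 9)`.
-/

namespace RandomTriangle

open MeasureTheory ProbabilityTheory Set Filter Topology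
open scoped ENNReal

/-! ### Iterated integrals and uniform points on segments -/

lemma setLIntegral_Ioo_swap (a b : ℝ) {f : ℝ → ℝ → ℝ≥0∞} (hf : Measurable (Function.uncurry f)) :
    ∫⁻ x in Ioo a b, ∫⁻ y in Ioo a x, f x y = ∫⁻ y in Ioo a b, ∫⁻ x in Ioo y b, f x y := by
  have below (x : ℝ) (hx : x ∈ Ioo a b) : ∫⁻ y in Ioo a x, f x y =
      ∫⁻ y in Ioo a b, {p : ℝ × ℝ | p.2 < p.1}.indicator (Function.uncurry f) (x, y) := by
    rw [show (fun y => {p : ℝ × ℝ | p.2 < p.1}.indicator (Function.uncurry f) (x, y)) =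
      (Iio x).indicator (f x) by ext y; simp [indicator, Function.uncurry],
      setLIntegral_indicator measurableSet_Iio, Iio_inter_Ioo, min_eq_left hx.2.le]
  have above (y : ℝ) (hy : y ∈ Ioo a b) : ∫⁻ x in Ioo y b, f x y =
      ∫⁻ x in Ioo a b, {p : ℝ × ℝ | p.2 < p.1}.indicator (Function.uncurry f) (x, y) := by
    rw [show (fun x => {p : ℝ × ℝ | p.2 < p.1}.indicator (Function.uncurry f) (x, y)) =
      (Ioi y).indicator (fun x => f x y) by ext x; simp [indicator, Function.uncurry],
      setLIntegral_indicator measurableSet_Ioi, Ioi_inter_Ioo, sup_eq_left.2 hy.1.le]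
  rw [setLIntegral_congr_fun measurableSet_Ioo below,
    setLIntegral_congr_fun measurableSet_Ioo above]
  exact lintegral_lintegral_swap
    (hf.indicator (measurableSet_lt measurable_snd measurable_fst)).aemeasurable

lemma setLIntegral_Ioo_add {a b c : ℝ} (hab : a < b) (hbc : b < c) (f : ℝ → ℝ≥0∞) :
    (∫⁻ x in Ioo a b, f x) + ∫⁻ x in Ioo b c, f x = ∫⁻ x in Ioo a c, f x := by
  rw [← Ioo_union_Ico_eq_Ioo hab hbc.le,
    lintegral_union measurableSet_Ico (Set.disjoint_left.2 fun x h h' => h.2.not_ge h'.1),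
    Measure.restrict_congr_set (Ioo_ae_eq_Ico (a := b) (b := c) (μ := volume)).symm]

lemma measurable_setLIntegral_Ioo {α : Type*} [MeasurableSpace α] {u v : α → ℝ} (hu : Measurable u)
    (hv : Measurable v) {f : α → ℝ → ℝ≥0∞} (hf : Measurable (Function.uncurry f)) :
    Measurable fun a => ∫⁻ y in Ioo (u a) (v a), f a y := by
  have h (a : α) : ∫⁻ y in Ioo (u a) (v a), f a y =
      ∫⁻ y, {p : α × ℝ | u p.1 < p.2 ∧ p.2 < v p.1}.indicator (Function.uncurry f) (a, y) := by
    rw [← lintegral_indicator measurableSet_Ioo]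
    exact lintegral_congr fun y => by simp [indicator, Function.uncurry]
  simp only [h]
  exact Measurable.lintegral_prod_right' (hf.indicator
    ((measurableSet_lt (hu.comp measurable_fst) measurable_snd).inter
      (measurableSet_lt measurable_snd (hv.comp measurable_fst))))

section SymmetricSquare

variable {f : ℝ → ℝ → ℝ≥0∞}

lemma setLIntegral_Ioo_Ioo_eq_two_mul_upper (hf : Measurable (Function.uncurry f))
    (hsymm : ∀ x y, f x y = f y x) (a b : ℝ) :
    ∫⁻ x in Ioo a b, ∫⁻ y in Ioo a b, f x y = 2 * ∫⁻ x in Ioo a b, ∫⁻ y in Ioo x b, f x y := by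
  have split (x : ℝ) (hx : x ∈ Ioo a b) : ∫⁻ y in Ioo a b, f x y =
      (∫⁻ y in Ioo a x, f x y) + ∫⁻ y in Ioo x b, f x y := (setLIntegral_Ioo_add hx.1 hx.2 _).symm
  rw [setLIntegral_congr_fun measurableSet_Ioo split,
    lintegral_add_left (measurable_setLIntegral_Ioo measurable_const measurable_id' hf),
    setLIntegral_Ioo_swap a b hf, two_mul]
  simp only [hsymm]

lemma setLIntegral_Ioo_Ioo_eq_two_mul_lower (hf : Measurable (Function.uncurry f))
    (hsymm : ∀ x y, f x y = f y x) (a b : ℝ) :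
    ∫⁻ x in Ioo a b, ∫⁻ y in Ioo a b, f x y = 2 * ∫⁻ x in Ioo a b, ∫⁻ y in Ioo a x, f x y := by
  rw [setLIntegral_Ioo_Ioo_eq_two_mul_upper hf hsymm, setLIntegral_Ioo_swap a b hf]
  simp only [hsymm]

end SymmetricSquare

/-- The uniform distribution on the segment between two reals, as the law of a point that divides
the segment in a uniformly distributed ratio. -/
noncomputable def uniformSegment (a b : ℝ) : Measure ℝ :=
  (volume.restrict (Ioo (0 : ℝ) 1)).map (AffineMap.lineMap a b)

instance (a b : ℝ) : IsFiniteMeasure (uniformSegment a b) :=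
  Measure.isFiniteMeasure_map _ _

lemma measurePreserving_one_sub_restrict_Ioo :
    MeasurePreserving (fun t : ℝ => 1 - t) (volume.restrict (Ioo 0 1))
      (volume.restrict (Ioo 0 1)) := by
  have h := (volume.measurePreserving_sub_left (1 : ℝ)).restrict_preimage
    (measurableSet_Ioo (a := (0 : ℝ)) (b := 1))
  rwa [preimage_const_sub_Ioo, sub_self, sub_zero] at h

lemma uniformSegment_comm (a b : ℝ) : uniformSegment a b = uniformSegment b a := by
  have h : (AffineMap.lineMap b a : ℝ → ℝ) = AffineMap.lineMap a b ∘ fun t => 1 - t :=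
    funext fun t => (AffineMap.lineMap_apply_one_sub a b t).symm
  rw [uniformSegment, uniformSegment, h, ← Measure.map_map
    (AffineMap.lineMap_continuous).measurable (by fun_prop),
    measurePreserving_one_sub_restrict_Ioo.map_eq]

lemma uniformSegment_of_lt {a b : ℝ} (hab : a < b) :
    uniformSegment a b = ENNReal.ofReal (b - a)⁻¹ • volume.restrict (Ioo a b) := by
  have hd : 0 < b - a := sub_pos.2 hab
  have image : AffineMap.lineMap a b '' Ioo (0 : ℝ) 1 = Ioo a b := by
    rw [show (AffineMap.lineMap a b : ℝ → ℝ) = fun t => (b - a) * t + a by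
      ext t; simp [AffineMap.lineMap_apply, mul_comm], image_affine_Ioo hd]
    simp
  refine Measure.ext_of_lintegral _ fun f hf => ?_
  rw [uniformSegment, lintegral_map hf AffineMap.lineMap_continuous.measurable,
    lintegral_smul_measure, ← image, lintegral_image_eq_lintegral_abs_deriv_mul measurableSet_Ioo
      (fun t _ => AffineMap.hasDerivWithinAt_lineMap)
      (AffineMap.lineMap_injective ℝ hab.ne).injOn,
    lintegral_const_mul' _ _ ENNReal.ofReal_ne_top, smul_eq_mul, ← mul_assoc, abs_of_pos hd,
    ← ENNReal.ofReal_mul (inv_nonneg.2 hd.le), inv_mul_cancel₀ hd.ne', ENNReal.ofReal_one, one_mul]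

lemma measurable_vec_three {α : Type*} [MeasurableSpace α] {u v w : α → ℝ} (hu : Measurable u)
    (hv : Measurable v) (hw : Measurable w) : Measurable fun a => ![u a, v a, w a] := by
  refine measurable_pi_iff.2 fun i => ?_
  fin_cases i
  exacts [hu, hv, hw]

lemma lintegral_pi_fin_three (ν : Fin 3 → Measure ℝ) [∀ i, SigmaFinite (ν i)]
    {F : (Fin 3 → ℝ) → ℝ≥0∞} (hF : Measurable F) :
    ∫⁻ x, F x ∂Measure.pi ν = ∫⁻ a, ∫⁻ b, ∫⁻ c, F ![a, b, c] ∂ν 2 ∂ν 1 ∂ν 0 := by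
  have vec_measurable : Measurable fun p : ℝ × ℝ × ℝ => ![p.1, p.2.1, p.2.2] :=
    measurable_vec_three (by fun_prop) (by fun_prop) (by fun_prop)
  have map_eq : Measure.pi ν =
      ((ν 0).prod ((ν 1).prod (ν 2))).map fun p => ![p.1, p.2.1, p.2.2] := by
    refine Measure.pi_eq fun s hs => ?_
    have preimage : (fun p : ℝ × ℝ × ℝ => ![p.1, p.2.1, p.2.2]) ⁻¹' univ.pi s =
        s 0 ×ˢ s 1 ×ˢ s 2 := by
      ext p
      simp [Fin.forall_fin_succ]
    rw [Measure.map_apply vec_measurable (MeasurableSet.univ_pi hs), preimage, Measure.prod_prod,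
      Measure.prod_prod, Fin.prod_univ_three, mul_assoc]
  have hF' : Measurable fun p : ℝ × ℝ × ℝ => F ![p.1, p.2.1, p.2.2] := hF.comp vec_measurable
  rw [map_eq, lintegral_map hF vec_measurable, lintegral_prod _ hF'.aemeasurable]
  exact lintegral_congr fun a => lintegral_prod _ (hF'.comp measurable_prodMk_left).aemeasurable

/-- The distribution of the three independent parameters that choose the next triangle. -/
noncomputable def unitCube : Measure (Fin 3 → ℝ) :=
  Measure.pi fun _ => volume.restrict (Ioo 0 1)

instance : IsProbabilityMeasure (volume.restrict (Ioo (0 : ℝ) 1)) := ⟨by simp⟩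

instance : IsProbabilityMeasure unitCube := by
  unfold unitCube
  infer_instance

/-- The one-dimensional counterpart of `subTriangle`, for the coordinates of the vertices of a
triangle along a line. -/
noncomputable def nextTriple (x t : Fin 3 → ℝ) : Fin 3 → ℝ := fun i =>
  AffineMap.lineMap (x (i + 1)) (x (i + 2)) (t i)

lemma measurable_nextTriple :
    Measurable fun p : (Fin 3 → ℝ) × (Fin 3 → ℝ) => nextTriple p.1 p.2 := by
  refine measurable_pi_iff.2 fun i => ?_
  simp only [nextTriple, AffineMap.lineMap_apply_module]
  fun_prop

lemma map_nextTriple_unitCube (x : Fin 3 → ℝ) :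
    unitCube.map (nextTriple x) =
      Measure.pi fun i => uniformSegment (x (i + 1)) (x (i + 2)) :=
  have (i : Fin 3) : SigmaFinite ((volume.restrict (Ioo (0 : ℝ) 1)).map
      (AffineMap.lineMap (x (i + 1)) (x (i + 2)))) :=
    inferInstanceAs (SigmaFinite (uniformSegment _ _))
  Measure.pi_map_pi fun i =>
    (AffineMap.lineMap_continuous (p := x (i + 1)) (q := x (i + 2))).measurable.aemeasurable

section NextTriple

variable {F : (Fin 3 → ℝ) → ℝ≥0∞}

lemma lintegral_nextTriple (hF : Measurable F) (x : Fin 3 → ℝ) :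
    ∫⁻ t, F (nextTriple x t) ∂unitCube =
      ∫⁻ y, F y ∂Measure.pi fun i => uniformSegment (x (i + 1)) (x (i + 2)) := by
  have measurable_next : Measurable (nextTriple x) :=
    measurable_nextTriple.comp measurable_prodMk_left
  rw [← map_nextTriple_unitCube, lintegral_map hF measurable_next]

lemma perm_opposite : ∀ (σ : Equiv.Perm (Fin 3)) (i : Fin 3),
    (σ (i + 1) = σ i + 1 ∧ σ (i + 2) = σ i + 2) ∨
      (σ (i + 1) = σ i + 2 ∧ σ (i + 2) = σ i + 1) := by
  decide

lemma lintegral_nextTriple_comp_perm (hF : Measurable F)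
    (hsymm : ∀ (σ : Equiv.Perm (Fin 3)) x, F (x ∘ σ) = F x) (σ : Equiv.Perm (Fin 3))
    (x : Fin 3 → ℝ) :
    ∫⁻ t, F (nextTriple (x ∘ σ) t) ∂unitCube = ∫⁻ t, F (nextTriple x t) ∂unitCube := by
  have segments (i : Fin 3) : uniformSegment ((x ∘ σ) (i + 1)) ((x ∘ σ) (i + 2)) =
      uniformSegment (x (σ i + 1)) (x (σ i + 2)) := by
    rcases perm_opposite σ i with ⟨h₁, h₂⟩ | ⟨h₁, h₂⟩
    · simp only [Function.comp_apply, h₁, h₂]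
    · simp only [Function.comp_apply, h₁, h₂, uniformSegment_comm]
  have perm := measurePreserving_piCongrLeft
    (fun i => uniformSegment (x (i + 1)) (x (i + 2))) σ
  rw [lintegral_nextTriple hF, lintegral_nextTriple hF, ← perm.lintegral_comp hF]
  simp only [segments]
  refine lintegral_congr fun y => ?_
  rw [← hsymm σ (MeasurableEquiv.piCongrLeft _ σ y)]
  congr 1
  ext i
  exact (Equiv.piCongrLeft_apply_apply (fun _ => ℝ) σ y i).symm

section ExtremesAndMiddle

variable {g : ℝ → ℝ → ℝ → ℝ≥0∞}

lemma measurable_setLIntegral_Ioo_middle (hg : Measurable fun p : ℝ × ℝ × ℝ => g p.1 p.2.1 p.2.2)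
    {u v : ℝ × ℝ → ℝ} (hu : Measurable u) (hv : Measurable v) :
    Measurable fun p : ℝ × ℝ => ∫⁻ e in Ioo (u p) (v p), g p.1 e p.2 :=
  measurable_setLIntegral_Ioo hu hv
    (hg.comp (f := fun q : (ℝ × ℝ) × ℝ => (q.1.1, q.2, q.1.2)) (by fun_prop))

lemma setLIntegral_Ioo_middle_split (hg : Measurable fun p : ℝ × ℝ × ℝ => g p.1 p.2.1 p.2.2)
    {l m h : ℝ} {u v : ℝ → ℝ} (hu : Measurable u) (hum : ∀ a ∈ Ioo l m, u a < m)
    (hvm : ∀ b ∈ Ioo m h, m < v b) :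
    ∫⁻ a in Ioo l m, ∫⁻ b in Ioo m h, ∫⁻ e in Ioo (u a) (v b), g a e b =
      (∫⁻ a in Ioo l m, ∫⁻ b in Ioo m h, ∫⁻ e in Ioo (u a) m, g a e b) +
        ∫⁻ a in Ioo l m, ∫⁻ b in Ioo m h, ∫⁻ e in Ioo m (v b), g a e b := by
  have measurable_left : Measurable fun p : ℝ × ℝ => ∫⁻ e in Ioo (u p.1) m, g p.1 e p.2 :=
    measurable_setLIntegral_Ioo_middle hg (hu.comp measurable_fst) measurable_const
  rw [← lintegral_add_left measurable_left.lintegral_prod_right']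
  refine setLIntegral_congr_fun measurableSet_Ioo fun a ha => ?_
  change _ = (∫⁻ b in Ioo m h, ∫⁻ e in Ioo (u a) m, g a e b) + _
  have measurable_slice : Measurable fun b => ∫⁻ e in Ioo (u a) m, g a e b :=
    measurable_left.comp measurable_prodMk_left
  rw [← lintegral_add_left measurable_slice]
  exact setLIntegral_congr_fun measurableSet_Ioo fun b hb =>
    (setLIntegral_Ioo_add (hum a ha) (hvm b hb) _).symm

lemma setLIntegral_Ioo_middle_eq_two_mul (hg : Measurable fun p : ℝ × ℝ × ℝ => g p.1 p.2.1 p.2.2)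
    (swap₁₂ : ∀ x y z, g x y z = g y x z) (swap₂₃ : ∀ x y z, g x y z = g x z y) {l m h : ℝ}
    (hlm : l < m) (hmh : m < h) :
    ∫⁻ a in Ioo l m, ∫⁻ b in Ioo m h, ∫⁻ e in Ioo l h, g a e b =
      2 * ∫⁻ a in Ioo l m, ∫⁻ b in Ioo m h, ∫⁻ e in Ioo a b, g a e b := by
  have lower : ∫⁻ a in Ioo l m, ∫⁻ b in Ioo m h, ∫⁻ e in Ioo l m, g a e b =
      2 * ∫⁻ a in Ioo l m, ∫⁻ b in Ioo m h, ∫⁻ e in Ioo a m, g a e b := by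
    rw [lintegral_lintegral_swap
        (measurable_setLIntegral_Ioo_middle hg measurable_const measurable_const).aemeasurable,
      lintegral_lintegral_swap (f := fun a b => ∫⁻ e in Ioo a m, g a e b)
        (measurable_setLIntegral_Ioo_middle hg measurable_fst measurable_const).aemeasurable,
      ← lintegral_const_mul' _ _ ENNReal.ofNat_ne_top]
    exact lintegral_congr fun b => setLIntegral_Ioo_Ioo_eq_two_mul_upper (f := fun a e => g a e b)
      (hg.comp (f := fun p : ℝ × ℝ => (p.1, p.2, b)) (by fun_prop)) (fun _ _ => swap₁₂ _ _ _) l m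
  have upper : ∫⁻ a in Ioo l m, ∫⁻ b in Ioo m h, ∫⁻ e in Ioo m h, g a e b =
      2 * ∫⁻ a in Ioo l m, ∫⁻ b in Ioo m h, ∫⁻ e in Ioo m b, g a e b := by
    rw [← lintegral_const_mul' _ _ ENNReal.ofNat_ne_top]
    exact lintegral_congr fun a => setLIntegral_Ioo_Ioo_eq_two_mul_lower (f := fun b e => g a e b)
      (hg.comp (f := fun p : ℝ × ℝ => (a, p.2, p.1)) (by fun_prop)) (fun _ _ => swap₂₃ _ _ _) m h
  rw [setLIntegral_Ioo_middle_split hg (u := fun _ => l) (v := fun _ => h) measurable_const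
      (fun _ _ => hlm) (fun _ _ => hmh), lower, upper,
    setLIntegral_Ioo_middle_split hg (u := fun a => a) (v := fun b => b) measurable_id
      (fun _ ha => ha.2) (fun _ hb => hb.1), mul_add]

end ExtremesAndMiddle

/-- Given its two extreme points, the middle point of the next triple is uniform between them. -/
lemma lintegral_nextTriple_sorted (hF : Measurable F)
    (hsymm : ∀ (σ : Equiv.Perm (Fin 3)) x, F (x ∘ σ) = F x) {l m h : ℝ} (hlm : l < m)
    (hmh : m < h) :
    ∫⁻ t, F (nextTriple ![l, m, h] t) ∂unitCube =
      ENNReal.ofReal (2 / ((m - l) * (h - m) * (h - l))) *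
        ∫⁻ a in Ioo l m, ∫⁻ b in Ioo m h, ∫⁻ e in Ioo a b, F ![a, e, b] := by
  have swap₁₂ (x y z : ℝ) : F ![x, y, z] = F ![y, x, z] := by
    rw [← hsymm (Equiv.swap 0 1)]; congr 1; ext i; fin_cases i <;> rfl
  have swap₂₃ (x y z : ℝ) : F ![x, y, z] = F ![x, z, y] := by
    rw [← hsymm (Equiv.swap 1 2)]; congr 1; ext i; fin_cases i <;> rfl
  have rotate : ![l, m, h] ∘ finRotate 3 ∘ finRotate 3 = ![h, l, m] := by
    ext i; fin_cases i <;> rfl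
  have measurable_vec : Measurable fun p : ℝ × ℝ × ℝ => ![p.1, p.2.1, p.2.2] :=
    measurable_vec_three (by fun_prop) (by fun_prop) (by fun_prop)
  have hlh := hlm.trans hmh
  calc ∫⁻ t, F (nextTriple ![l, m, h] t) ∂unitCube
      = ∫⁻ t, F (nextTriple ![h, l, m] t) ∂unitCube := by
        rw [← rotate, ← lintegral_nextTriple_comp_perm hF hsymm (finRotate 3 * finRotate 3)]
        rfl
    _ = ∫⁻ a, ∫⁻ b, ∫⁻ e, F ![a, e, b] ∂uniformSegment l h ∂uniformSegment m h
          ∂uniformSegment l m := by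
        rw [lintegral_nextTriple hF, lintegral_pi_fin_three _ hF, uniformSegment_comm l h]
        simp only [swap₂₃]
        rfl
    _ = ENNReal.ofReal (m - l)⁻¹ * (ENNReal.ofReal (h - m)⁻¹ * (ENNReal.ofReal (h - l)⁻¹ *
          ∫⁻ a in Ioo l m, ∫⁻ b in Ioo m h, ∫⁻ e in Ioo l h, F ![a, e, b])) := by
        simp only [uniformSegment_of_lt, hlm, hmh, hlh, lintegral_smul_measure, smul_eq_mul]
        simp only [lintegral_const_mul' _ _ ENNReal.ofReal_ne_top]
    _ = _ := by
        have := sub_pos.2 hlm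
        have := sub_pos.2 hmh
        have := sub_pos.2 hlh
        rw [setLIntegral_Ioo_middle_eq_two_mul (hF.comp measurable_vec) swap₁₂ swap₂₃ hlm hmh,
          ← ENNReal.ofReal_ofNat 2, ← mul_assoc, ← mul_assoc, ← mul_assoc,
          ← ENNReal.ofReal_mul (by positivity), ← ENNReal.ofReal_mul (by positivity),
          ← ENNReal.ofReal_mul (by positivity)]
        congr 2
        field_simp

end NextTriple

lemma exists_perm_comp_eq_of_injective {x : Fin 3 → ℝ} (hx : Function.Injective x) :
    ∃ (σ : Equiv.Perm (Fin 3)) (l m h : ℝ), l < m ∧ m < h ∧ x ∘ σ = ![l, m, h] := by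
  have strictMono := (Tuple.monotone_sort x).strictMono_of_injective
    (hx.comp (Tuple.sort x).injective)
  refine ⟨Tuple.sort x, _, _, _, strictMono (show (0 : Fin 3) < 1 by decide),
    strictMono (show (1 : Fin 3) < 2 by decide), ?_⟩
  ext i
  fin_cases i <;> rfl

/-! ### The contraction factor for negative moments of the spread -/

lemma nonneg_of_concaveOn_deriv {f f' : ℝ → ℝ} (hf : ContinuousOn f (Icc 0 1))
    (hf' : ∀ x ∈ Ioo (0 : ℝ) 1, HasDerivAt f (f' x) x) (hconc : ConcaveOn ℝ (Icc 0 1) f')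
    (hf'0 : f' 0 = 0) (hf0 : f 0 = 0) (hf1 : f 1 = 0) {x : ℝ} (hx : x ∈ Icc (0 : ℝ) 1) :
    0 ≤ f x := by
  have star {a b : ℝ} (ha : 0 ≤ a) (hab : a ≤ b) (hb : 0 < b) (hb1 : b ≤ 1) :
      a / b * f' b ≤ f' a := by
    have h := hconc.2 (x := 0) (y := b) ⟨le_rfl, zero_le_one⟩ ⟨hb.le, hb1⟩
      (sub_nonneg.2 ((div_le_one hb).2 hab)) (div_nonneg ha hb.le) (sub_add_cancel 1 (a / b))
    simpa only [hf'0, smul_eq_mul, mul_zero, zero_add, div_mul_cancel₀ a hb.ne'] using h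
  rcases hx.1.eq_or_lt with rfl | hx0
  · exact hf0.ge
  rcases le_or_gt 0 (f' x) with hpos | hneg
  · have mono : MonotoneOn f (Icc 0 x) := by
      refine monotoneOn_of_hasDerivWithinAt_nonneg (f' := f') (convex_Icc 0 x)
        (hf.mono (Icc_subset_Icc_right hx.2)) (fun y hy => ?_) fun y hy => ?_ <;>
      rw [interior_Icc] at hy
      · exact (hf' y ⟨hy.1, hy.2.trans_le hx.2⟩).hasDerivWithinAt
      · exact (mul_nonneg (div_nonneg hy.1.le hx0.le) hpos).trans
          (star hy.1.le hy.2.le hx0 hx.2)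
    exact hf0 ▸ mono ⟨le_rfl, hx0.le⟩ ⟨hx0.le, le_rfl⟩ hx0.le
  · have anti : AntitoneOn f (Icc x 1) := by
      refine antitoneOn_of_hasDerivWithinAt_nonpos (f' := f') (convex_Icc x 1)
        (hf.mono (Icc_subset_Icc_left hx.1)) (fun y hy => ?_) fun y hy => ?_ <;>
      rw [interior_Icc] at hy
      · exact (hf' y ⟨hx0.trans hy.1, hy.2⟩).hasDerivWithinAt
      · by_contra! hy_pos
        have hy0 := hx0.trans hy.1
        exact (hneg.trans (mul_pos (div_pos hx0 hy0) hy_pos)).not_ge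
          (star hx0.le hy.1.le hy0 hy.2.le)
    exact hf1 ▸ anti ⟨le_rfl, hx.2⟩ ⟨hx.2, le_rfl⟩ hx.2

lemma concaveOn_one_add_rpow_sub_one_sub_rpow {q : ℝ} (hq₁ : 1 ≤ q) (hq₂ : q ≤ 2) :
    ConcaveOn ℝ (Icc 0 1) fun x : ℝ => (1 + x) ^ q - (1 - x) ^ q := by
  have deriv_rpow (r : ℝ) {x : ℝ} (hx : x ∈ Ioo (0 : ℝ) 1) :
      HasDerivAt (fun y : ℝ => (1 + y) ^ r) (r * (1 + x) ^ (r - 1)) x ∧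
        HasDerivAt (fun y : ℝ => (1 - y) ^ r) (-(r * (1 - x) ^ (r - 1))) x := by
    constructor
    · simpa using ((hasDerivAt_id x).const_add 1).rpow_const (p := r)
        (Or.inl (by simp only [id]; linarith [hx.1]))
    · simpa using ((hasDerivAt_id x).const_sub 1).rpow_const (p := r)
        (Or.inl (by simp only [id]; linarith [hx.2]))
  refine concaveOn_of_hasDerivWithinAt2_nonpos (convex_Icc 0 1)
    (f' := fun x => q * (1 + x) ^ (q - 1) - -(q * (1 - x) ^ (q - 1)))
    (f'' := fun x => q * ((q - 1) * (1 + x) ^ (q - 1 - 1)) -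
      -(q * -((q - 1) * (1 - x) ^ (q - 1 - 1)))) ?_ ?_ ?_ ?_
  · exact ((continuous_const.add continuous_id).rpow_const fun _ => Or.inr (by linarith)).sub
      ((continuous_const.sub continuous_id).rpow_const fun _ => Or.inr (by linarith))
      |>.continuousOn
  all_goals
    intro x hx
    rw [interior_Icc] at hx
  · exact ((deriv_rpow q hx).1.sub (deriv_rpow q hx).2).hasDerivWithinAt
  · exact (((deriv_rpow (q - 1) hx).1.const_mul q).sub
      ((deriv_rpow (q - 1) hx).2.const_mul q).neg).hasDerivWithinAt
  · have h : (1 + x) ^ (q - 1 - 1) ≤ (1 - x) ^ (q - 1 - 1) :=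
      Real.rpow_le_rpow_of_nonpos (by linarith [hx.2]) (by linarith [hx.1]) (by linarith)
    nlinarith [mul_nonneg (by linarith : 0 ≤ q) (sub_nonneg.2 hq₁)]

/- `x ↦ (1 + x) ^ p + (1 - x) ^ p` is a concave function of `x ^ 2`, because its derivative is
concave and vanishes at `0`; hence it lies above its chord. -/
lemma two_add_mul_sq_le_one_add_rpow_add_one_sub_rpow {p : ℝ} (hp₂ : 2 ≤ p) (hp₃ : p ≤ 3) {x : ℝ}
    (hx : x ∈ Icc (0 : ℝ) 1) :
    2 + (2 ^ p - 2) * x ^ 2 ≤ (1 + x) ^ p + (1 - x) ^ p := by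
  refine sub_nonneg.1 (nonneg_of_concaveOn_deriv
    (f := fun x => (1 + x) ^ p + (1 - x) ^ p - (2 + (2 ^ p - 2) * x ^ 2))
    (f' := fun x => p * ((1 + x) ^ (p - 1) - (1 - x) ^ (p - 1)) + -(2 * (2 ^ p - 2)) * x)
    ?_ (fun y hy => ?_) ?_ ?_ ?_ ?_ hx)
  · exact ((((continuous_const.add continuous_id).rpow_const fun _ => Or.inr (by linarith)).add
      ((continuous_const.sub continuous_id).rpow_const fun _ => Or.inr (by linarith))).sub
      (by fun_prop)).continuousOn
  · have h := ((((hasDerivAt_id y).const_add 1).rpow_const (p := p)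
      (Or.inl (by simp only [id]; linarith [hy.1]))).add
      (((hasDerivAt_id y).const_sub 1).rpow_const (p := p)
      (Or.inl (by simp only [id]; linarith [hy.2])))).sub
      ((((hasDerivAt_id y).pow 2).const_mul (2 ^ p - 2 : ℝ)).const_add 2)
    refine h.congr_deriv ?_
    simp only [id]
    ring
  · refine ((concaveOn_one_add_rpow_sub_one_sub_rpow (q := p - 1) (by linarith)
      (by linarith)).smul (by linarith : (0 : ℝ) ≤ p)).add ?_
    exact (LinearMap.mulLeft ℝ (-(2 * (2 ^ p - 2)))).concaveOn (convex_Icc 0 1)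
  · simp
  · norm_num
  · norm_num [Real.zero_rpow (by linarith : p ≠ 0)]

lemma add_rpow_le_rpow_add_rpow_add {p : ℝ} (hp₂ : 2 ≤ p) (hp₃ : p ≤ 3) {u v : ℝ} (hu : 0 < u)
    (hv : 0 < v) :
    (u + v) ^ p ≤ u ^ p + v ^ p + 4 * (1 - 2 ^ (1 - p)) * (u * v) * (u + v) ^ (p - 2) := by
  wlog huv : v ≤ u generalizing u v
  · simpa only [add_comm u, mul_comm u, add_comm (u ^ p)] using this hv hu (le_of_not_ge huv)
  set L := u + v
  have hL : 0 < L := by positivity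
  set x := (u - v) / L with hx_def
  have hx : x ∈ Icc (0 : ℝ) 1 :=
    ⟨div_nonneg (sub_nonneg.2 huv) hL.le, (div_le_one hL).2 (by linarith)⟩
  have chord := two_add_mul_sq_le_one_add_rpow_add_one_sub_rpow hp₂ hp₃ hx
  have hu_eq : u = L / 2 * (1 + x) := by rw [hx_def]; field_simp; linarith
  have hv_eq : v = L / 2 * (1 - x) := by rw [hx_def]; field_simp; linarith
  have hup : u ^ p = L ^ p * 2⁻¹ ^ p * (1 + x) ^ p := by
    conv_lhs => rw [hu_eq, Real.mul_rpow (by positivity) (by linarith [hx.1]), div_eq_mul_inv,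
      Real.mul_rpow hL.le (by norm_num)]
  have hvp : v ^ p = L ^ p * 2⁻¹ ^ p * (1 - x) ^ p := by
    conv_lhs => rw [hv_eq, Real.mul_rpow (by positivity) (by linarith [hx.2]), div_eq_mul_inv,
      Real.mul_rpow hL.le (by norm_num)]
  have huvL : u * v * L ^ (p - 2) = L ^ p * ((1 - x ^ 2) / 4) := by
    have : L ^ p = L ^ (p - 2) * L ^ 2 := by
      rw [← Real.rpow_natCast, ← Real.rpow_add hL]; norm_num
    rw [this]
    conv_lhs => rw [hu_eq, hv_eq]
    ring
  have two_pow : (2 : ℝ) ^ (1 - p) = 2 * 2⁻¹ ^ p := by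
    rw [Real.rpow_sub two_pos, Real.rpow_one, Real.inv_rpow two_pos.le]; rfl
  have half_pow : (2 : ℝ) ^ p * 2⁻¹ ^ p = 1 := by
    rw [← Real.mul_rpow (by norm_num) (by norm_num)]; norm_num
  rw [mul_assoc _ (u * v), huvL, hup, hvp, two_pow]
  have h := mul_le_mul_of_nonneg_left chord (by positivity : 0 ≤ L ^ p * 2⁻¹ ^ p)
  linear_combination h - L ^ p * x ^ 2 * half_pow

/-- A bound, exact to first order at `s = 0`, for the factor by which one step of the process
changes the mean of the `-s`-th power of the spread. -/
noncomputable def spreadMoment (s : ℝ) : ℝ :=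
  8 * (1 - 2 ^ (s - 2)) / ((2 - s) * (3 - s))

lemma spreadMoment_nonneg {s : ℝ} (hs : s ≤ 1) : 0 ≤ spreadMoment s := by
  have : (2 : ℝ) ^ (s - 2) ≤ 1 := Real.rpow_le_one_of_one_le_of_nonpos one_le_two (by linarith)
  exact div_nonneg (by linarith) (mul_nonneg (by linarith) (by linarith))

lemma spreadMoment_zero : spreadMoment 0 = 1 := by
  norm_num [spreadMoment, Real.rpow_neg, Real.rpow_ofNat]

lemma hasDerivAt_spreadMoment_zero :
    HasDerivAt spreadMoment (5 / 6 - Real.log 2 / 3) 0 := by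
  have hpow : HasDerivAt (fun s : ℝ => (2 : ℝ) ^ (s - 2)) (Real.log 2 * 1 * 2 ^ ((0 : ℝ) - 2)) 0 :=
    ((hasDerivAt_id (0 : ℝ)).sub_const 2).const_rpow two_pos
  have h := ((hpow.const_sub 1).const_mul 8).div
    (((hasDerivAt_id (0 : ℝ)).const_sub 2).mul ((hasDerivAt_id (0 : ℝ)).const_sub 3))
    (by norm_num)
  refine h.congr_deriv ?_
  norm_num [Real.rpow_neg, Real.rpow_ofNat]
  ring

lemma exists_spreadMoment_lt_exp {κ : ℝ} (hκ : 5 / 6 - Real.log 2 / 3 < κ) :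
    ∃ s ∈ Ioc (0 : ℝ) 1, spreadMoment s < Real.exp (κ * s) := by
  have hexp : HasDerivAt (fun s => Real.exp (κ * s)) κ 0 := by
    simpa using ((hasDerivAt_id (0 : ℝ)).const_mul κ).exp
  have slope_tendsto := (hasDerivAt_iff_tendsto_slope.1
    (hexp.sub hasDerivAt_spreadMoment_zero)).mono_left (nhdsGT_le_nhdsNE 0)
  obtain ⟨s, hslope, hs⟩ := ((slope_tendsto.eventually (lt_mem_nhds (sub_pos.2 hκ))).and
    (Ioc_mem_nhdsGT one_pos)).exists
  refine ⟨s, hs, ?_⟩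
  simpa [slope_def_field, spreadMoment_zero, hs.1, div_pos_iff_of_pos_right] using hslope

/-! ### Spread and product of the gaps of three reals -/

lemma setLIntegral_Ioo_ofReal_deriv {g g' : ℝ → ℝ} {a b : ℝ} (hab : a ≤ b)
    (hcont : ContinuousOn g (Icc a b)) (hderiv : ∀ x ∈ Ioo a b, HasDerivAt g (g' x) x)
    (hpos : ∀ x ∈ Ioo a b, 0 ≤ g' x) :
    ∫⁻ x in Ioo a b, ENNReal.ofReal (g' x) = ENNReal.ofReal (g b - g a) := by
  have integrable := intervalIntegral.integrableOn_deriv_of_nonneg hcont hderiv hpos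
  rw [← intervalIntegral.integral_eq_sub_of_hasDerivAt_of_le hab hcont hderiv
      ((intervalIntegrable_iff_integrableOn_Ioc_of_le hab).2 integrable),
    intervalIntegral.integral_of_le hab, integral_Ioc_eq_integral_Ioo]
  exact (ofReal_integral_eq_lintegral_ofReal (integrable.mono_set Ioo_subset_Ioc_self)
    (ae_restrict_of_forall_mem measurableSet_Ioo hpos)).symm

lemma setLIntegral_Ioo_sub_left_rpow {p : ℝ} (hp : -1 < p) {a b c : ℝ} (hca : c ≤ a)
    (hab : a ≤ b) :
    ∫⁻ x in Ioo a b, ENNReal.ofReal ((x - c) ^ p) =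
      ENNReal.ofReal ((b - c) ^ (p + 1) / (p + 1) - (a - c) ^ (p + 1) / (p + 1)) := by
  have hp' : 0 < p + 1 := by linarith
  refine setLIntegral_Ioo_ofReal_deriv (g := fun x => (x - c) ^ (p + 1) / (p + 1)) hab ?_
    (fun x hx => ?_) fun x hx => Real.rpow_nonneg (by linarith [hx.1]) _
  · exact (((continuous_id.sub continuous_const).rpow_const fun _ =>
      Or.inr hp'.le).div_const _).continuousOn
  · have h := (((hasDerivAt_id x).sub_const c).rpow_const (p := p + 1)
      (Or.inl (by simp only [id]; linarith [hx.1]))).div_const (p + 1)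
    refine h.congr_deriv ?_
    simp only [id, add_sub_cancel_right]
    field_simp

lemma setLIntegral_Ioo_sub_right_rpow {p : ℝ} (hp : -1 < p) {a b c : ℝ} (hbc : b ≤ c)
    (hab : a ≤ b) :
    ∫⁻ x in Ioo a b, ENNReal.ofReal ((c - x) ^ p) =
      ENNReal.ofReal ((c - a) ^ (p + 1) / (p + 1) - (c - b) ^ (p + 1) / (p + 1)) := by
  have hp' : 0 < p + 1 := by linarith
  have h := setLIntegral_Ioo_ofReal_deriv (g := fun x => -((c - x) ^ (p + 1) / (p + 1)))
    (g' := fun x => (c - x) ^ p) hab ?_ (fun x hx => ?_)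
    fun x hx => Real.rpow_nonneg (by linarith [hx.2]) _
  · rw [h]
    congr 1
    ring
  · exact (((continuous_const.sub continuous_id).rpow_const fun _ =>
      Or.inr hp'.le).div_const _).neg.continuousOn
  · have h := ((((hasDerivAt_id x).const_sub c).rpow_const (p := p + 1)
      (Or.inl (by simp only [id]; linarith [hx.2]))).div_const (p + 1)).neg
    refine h.congr_deriv ?_
    simp only [id, add_sub_cancel_right]
    field_simp

lemma setLIntegral_Ioo_Ioo_sub_rpow {p : ℝ} (hp : 0 ≤ p) {l m h : ℝ} (hlm : l ≤ m)
    (hmh : m ≤ h) :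
    ∫⁻ a in Ioo l m, ∫⁻ b in Ioo m h, ENNReal.ofReal ((b - a) ^ p) =
      ENNReal.ofReal (((h - l) ^ (p + 2) - (m - l) ^ (p + 2) - (h - m) ^ (p + 2)) /
        ((p + 1) * (p + 2))) := by
  have hp₁ : 0 < p + 1 := by linarith
  have hp₂ : 0 < p + 2 := by linarith
  have inner (a : ℝ) (ha : a ∈ Ioo l m) : ∫⁻ b in Ioo m h, ENNReal.ofReal ((b - a) ^ p) =
      ENNReal.ofReal (((h - a) ^ (p + 1) - (m - a) ^ (p + 1)) / (p + 1)) := by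
    rw [setLIntegral_Ioo_sub_left_rpow (by linarith) ha.2.le hmh, sub_div]
  have deriv_sub_rpow {a c : ℝ} (hac : a < c) :
      HasDerivAt (fun a => (c - a) ^ (p + 2)) (-((p + 2) * (c - a) ^ (p + 1))) a := by
    have h := ((hasDerivAt_id a).const_sub c).rpow_const (p := p + 2)
      (Or.inl (by simp only [id]; linarith))
    refine h.congr_deriv ?_
    rw [show p + 2 - 1 = p + 1 by ring, id]
    ring
  rw [setLIntegral_congr_fun measurableSet_Ioo inner, setLIntegral_Ioo_ofReal_deriv
    (g := fun a => ((m - a) ^ (p + 2) - (h - a) ^ (p + 2)) / ((p + 1) * (p + 2))) hlm]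
  · rw [sub_self, Real.zero_rpow hp₂.ne']
    congr 1
    ring
  · exact ((((continuous_const.sub continuous_id).rpow_const fun _ => Or.inr hp₂.le).sub
      ((continuous_const.sub continuous_id).rpow_const fun _ => Or.inr hp₂.le)).div_const
        _).continuousOn
  · intro a ha
    refine (((deriv_sub_rpow ha.2).sub (deriv_sub_rpow (ha.2.trans_le hmh))).div_const
      ((p + 1) * (p + 2))).congr_deriv ?_
    field_simp
    ring
  · intro a ha
    have : (m - a) ^ (p + 1) ≤ (h - a) ^ (p + 1) :=
      Real.rpow_le_rpow (by linarith [ha.2]) (by linarith) hp₁.le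
    exact div_nonneg (sub_nonneg.2 this) hp₁.le

/-- The difference between the largest and the smallest of three reals. -/
noncomputable def spread (x : Fin 3 → ℝ) : ℝ := (∑ i, |x (i + 1) - x (i + 2)|) / 2

/-- The product of the two gaps between consecutive values of three reals, as the product of all
three distances divided by the largest one; it is `0` if two of the reals coincide. -/
noncomputable def gapProduct (x : Fin 3 → ℝ) : ℝ := (∏ i, |x (i + 1) - x (i + 2)|) / spread x

lemma measurable_spread : Measurable spread := by
  unfold spread
  fun_prop

lemma measurable_gapProduct : Measurable gapProduct := by
  unfold gapProduct
  exact (by fun_prop : Measurable _).div measurable_spread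

lemma abs_sub_comp_perm (x : Fin 3 → ℝ) (σ : Equiv.Perm (Fin 3)) (i : Fin 3) :
    |(x ∘ σ) (i + 1) - (x ∘ σ) (i + 2)| = |x (σ i + 1) - x (σ i + 2)| := by
  rcases perm_opposite σ i with ⟨h₁, h₂⟩ | ⟨h₁, h₂⟩
  · simp only [Function.comp_apply, h₁, h₂]
  · simp only [Function.comp_apply, h₁, h₂, abs_sub_comm]

lemma spread_comp_perm (x : Fin 3 → ℝ) (σ : Equiv.Perm (Fin 3)) : spread (x ∘ σ) = spread x := by
  simp only [spread, abs_sub_comp_perm, Equiv.sum_comp σ fun i => |x (i + 1) - x (i + 2)|]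

lemma gapProduct_comp_perm (x : Fin 3 → ℝ) (σ : Equiv.Perm (Fin 3)) :
    gapProduct (x ∘ σ) = gapProduct x := by
  simp only [gapProduct, spread_comp_perm, abs_sub_comp_perm,
    Equiv.prod_comp σ fun i => |x (i + 1) - x (i + 2)|]

section Sorted

variable {l m h : ℝ}

lemma spread_sorted (hlm : l ≤ m) (hmh : m ≤ h) : spread ![l, m, h] = h - l := by
  have h₀ : |m - h| = h - m := by rw [abs_sub_comm, abs_of_nonneg (sub_nonneg.2 hmh)]
  have h₁ : |h - l| = h - l := abs_of_nonneg (sub_nonneg.2 (hlm.trans hmh))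
  have h₂ : |l - m| = m - l := by rw [abs_sub_comm, abs_of_nonneg (sub_nonneg.2 hlm)]
  simp only [spread, Fin.sum_univ_three, Fin.isValue, Fin.reduceAdd, zero_add, Matrix.cons_val,
    h₀, h₁, h₂]
  ring

lemma gapProduct_sorted (hlm : l < m) (hmh : m < h) :
    gapProduct ![l, m, h] = (m - l) * (h - m) := by
  have hlh : 0 < h - l := sub_pos.2 (hlm.trans hmh)
  have h₀ : |m - h| = h - m := by rw [abs_sub_comm, abs_of_pos (sub_pos.2 hmh)]
  have h₁ : |h - l| = h - l := abs_of_pos hlh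
  have h₂ : |l - m| = m - l := by rw [abs_sub_comm, abs_of_pos (sub_pos.2 hlm)]
  rw [gapProduct, spread_sorted hlm.le hmh.le]
  simp only [Fin.prod_univ_three, Fin.isValue, Fin.reduceAdd, zero_add, Matrix.cons_val, h₀, h₁, h₂]
  field_simp

end Sorted

lemma spread_nonneg (x : Fin 3 → ℝ) : 0 ≤ spread x := by
  unfold spread
  positivity

lemma injective_of_gapProduct_ne_zero {x : Fin 3 → ℝ} (hx : gapProduct x ≠ 0) :
    Function.Injective x := by
  have ne (i : Fin 3) : x (i + 1) ≠ x (i + 2) := fun h => hx <| by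
    rw [gapProduct, Finset.prod_eq_zero (Finset.mem_univ i) (by rw [h, sub_self, abs_zero]),
      zero_div]
  have h₀ : x 1 ≠ x 2 := ne 0
  have h₁ : x 2 ≠ x 0 := ne 1
  have h₂ : x 0 ≠ x 1 := ne 2
  intro i j hij
  fin_cases i <;> fin_cases j <;> simp_all

lemma four_mul_gapProduct_le_spread_sq {x : Fin 3 → ℝ} (hx : Function.Injective x) :
    4 * gapProduct x ≤ spread x ^ 2 := by
  obtain ⟨σ, l, m, h, hlm, hmh, hσ⟩ := exists_perm_comp_eq_of_injective hx
  rw [← spread_comp_perm x σ, ← gapProduct_comp_perm x σ, hσ, spread_sorted hlm.le hmh.le,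
    gapProduct_sorted hlm hmh]
  linarith [sq_nonneg ((m - l) - (h - m))]

lemma spread_pos {x : Fin 3 → ℝ} (hx : Function.Injective x) : 0 < spread x := by
  have : 0 < |x 0 - x 1| := abs_pos.2 (sub_ne_zero.2 (hx.ne (by decide)))
  exact div_pos (Finset.sum_pos' (fun _ _ => abs_nonneg _) ⟨2, Finset.mem_univ _, this⟩) two_pos

section OneStep

variable {s : ℝ}

lemma mul_le_spreadMoment_mul_rpow (hs₀ : 0 ≤ s) (hs₁ : s ≤ 1) {u v : ℝ} (hu : 0 < u)
    (hv : 0 < v) :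
    2 / (u * v * (u + v)) * (((u + v) ^ (3 - s) - u ^ (3 - s) - v ^ (3 - s)) /
      ((2 - s) * (3 - s))) ≤ spreadMoment s * (u + v) ^ (-s) := by
  have hL : 0 < u + v := add_pos hu hv
  have h₂ : 0 < 2 - s := by linarith
  have h₃ : 0 < 3 - s := by linarith
  have key := add_rpow_le_rpow_add_rpow_add (p := 3 - s) (by linarith) (by linarith) hu hv
  rw [show 1 - (3 - s) = s - 2 by ring, show 3 - s - 2 = 1 + -s by ring, Real.rpow_add hL,
    Real.rpow_one] at key
  have bound : 2 / (u * v * (u + v)) * ((4 * (1 - 2 ^ (s - 2)) * (u * v) *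
      ((u + v) * (u + v) ^ (-s))) / ((2 - s) * (3 - s))) = spreadMoment s * (u + v) ^ (-s) := by
    unfold spreadMoment
    field_simp
    ring
  rw [← bound]
  gcongr
  linarith

lemma lintegral_nextTriple_le_of_middle (hs₀ : 0 ≤ s) (hs₁ : s ≤ 1)
    {F : (Fin 3 → ℝ) → ℝ≥0∞} (hF : Measurable F)
    (hsymm : ∀ (σ : Equiv.Perm (Fin 3)) x, F (x ∘ σ) = F x) {C : ℝ} (hC : 0 ≤ C)
    (hmid : ∀ a b : ℝ, a < b →
      ∫⁻ e in Ioo a b, F ![a, e, b] ≤ ENNReal.ofReal (C * (b - a) ^ (1 - s)))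
    {x : Fin 3 → ℝ} (hx : Function.Injective x) :
    ∫⁻ t, F (nextTriple x t) ∂unitCube ≤
      ENNReal.ofReal (C * spreadMoment s) * ENNReal.ofReal (spread x) ^ (-s) := by
  obtain ⟨σ, l, m, h, hlm, hmh, hσ⟩ := exists_perm_comp_eq_of_injective hx
  have hu : 0 < m - l := sub_pos.2 hlm
  have hv : 0 < h - m := sub_pos.2 hmh
  have hL : (m - l) + (h - m) = h - l := by ring
  have hL₀ : 0 < h - l := hL ▸ add_pos hu hv
  rw [← lintegral_nextTriple_comp_perm hF hsymm σ, ← spread_comp_perm x σ, hσ,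
    spread_sorted hlm.le hmh.le, ENNReal.ofReal_rpow_of_pos hL₀, ← ENNReal.ofReal_mul
    (mul_nonneg hC (spreadMoment_nonneg hs₁)), lintegral_nextTriple_sorted hF hsymm hlm hmh]
  calc ENNReal.ofReal (2 / ((m - l) * (h - m) * (h - l))) *
        ∫⁻ a in Ioo l m, ∫⁻ b in Ioo m h, ∫⁻ e in Ioo a b, F ![a, e, b]
      ≤ ENNReal.ofReal (2 / ((m - l) * (h - m) * (h - l))) *
          ∫⁻ a in Ioo l m, ∫⁻ b in Ioo m h, ENNReal.ofReal (C * (b - a) ^ (1 - s)) := by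
        gcongr 1
        exact setLIntegral_mono' measurableSet_Ioo fun a ha =>
          setLIntegral_mono' measurableSet_Ioo fun b hb => hmid a b (ha.2.trans hb.1)
    _ = ENNReal.ofReal (C * (2 / ((m - l) * (h - m) * (h - l)) *
          (((h - l) ^ (3 - s) - (m - l) ^ (3 - s) - (h - m) ^ (3 - s)) /
            ((2 - s) * (3 - s))))) := by
        simp only [ENNReal.ofReal_mul hC, lintegral_const_mul' _ _ ENNReal.ofReal_ne_top]
        rw [setLIntegral_Ioo_Ioo_sub_rpow (by linarith) hlm.le hmh.le,
          show 1 - s + 2 = 3 - s by ring, show 1 - s + 1 = 2 - s by ring, mul_left_comm,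
          ← ENNReal.ofReal_mul (by positivity)]
    _ ≤ ENNReal.ofReal (C * spreadMoment s * (h - l) ^ (-s)) := by
        rw [mul_assoc C]
        refine ENNReal.ofReal_le_ofReal (mul_le_mul_of_nonneg_left ?_ hC)
        simpa only [hL] using mul_le_spreadMoment_mul_rpow hs₀ hs₁ hu hv

lemma lintegral_spread_nextTriple_le (hs₀ : 0 ≤ s) (hs₁ : s ≤ 1) {x : Fin 3 → ℝ}
    (hx : Function.Injective x) :
    ∫⁻ t, ENNReal.ofReal (spread (nextTriple x t)) ^ (-s) ∂unitCube ≤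
      ENNReal.ofReal (spreadMoment s) * ENNReal.ofReal (spread x) ^ (-s) := by
  have h := lintegral_nextTriple_le_of_middle hs₀ hs₁
    (F := fun x => ENNReal.ofReal (spread x) ^ (-s))
    (measurable_spread.ennreal_ofReal.pow_const _)
    (fun σ x => by rw [spread_comp_perm]) zero_le_one (fun a b hab => ?_) hx
  · rwa [one_mul] at h
  have hd : 0 < b - a := sub_pos.2 hab
  rw [setLIntegral_congr_fun measurableSet_Ioo fun e he => by
    rw [spread_sorted he.1.le he.2.le, ENNReal.ofReal_rpow_of_pos hd], setLIntegral_const,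
    Real.volume_Ioo, ← ENNReal.ofReal_mul (by positivity), one_mul,
    show 1 - s = -s + 1 by ring, Real.rpow_add hd, Real.rpow_one]

lemma mul_rpow_neg_le {r : ℝ} (hr₀ : 0 ≤ r) (hr₁ : r ≤ 1) {u v : ℝ} (hu : 0 < u) (hv : 0 < v) :
    (u * v) ^ (-r) ≤ (u + v) ^ (-r) * (u ^ (-r) + v ^ (-r)) := by
  have subadd := Real.rpow_add_le_add_rpow hu.le hv.le hr₀ hr₁
  rw [Real.rpow_neg (by positivity), Real.rpow_neg (by positivity), Real.rpow_neg hu.le,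
    Real.rpow_neg hv.le, Real.mul_rpow hu.le hv.le]
  have := Real.rpow_pos_of_pos hu r
  have := Real.rpow_pos_of_pos hv r
  have := Real.rpow_pos_of_pos (add_pos hu hv) r
  field_simp
  linarith

lemma setLIntegral_gapProduct_middle_le (hs₀ : 0 ≤ s) (hs₁ : s ≤ 1) {a b : ℝ} (hab : a < b) :
    ∫⁻ e in Ioo a b, ENNReal.ofReal (gapProduct ![a, e, b]) ^ (-(s / 2)) ≤
      ENNReal.ofReal (4 * (b - a) ^ (1 - s)) := by
  have hd : 0 < b - a := sub_pos.2 hab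
  have pointwise (e : ℝ) (he : e ∈ Ioo a b) :
      ENNReal.ofReal (gapProduct ![a, e, b]) ^ (-(s / 2)) ≤
        ENNReal.ofReal ((b - a) ^ (-(s / 2))) *
          (ENNReal.ofReal ((e - a) ^ (-(s / 2))) + ENNReal.ofReal ((b - e) ^ (-(s / 2)))) := by
    have hu : 0 < e - a := sub_pos.2 he.1
    have hv : 0 < b - e := sub_pos.2 he.2
    rw [gapProduct_sorted he.1 he.2, ENNReal.ofReal_rpow_of_pos (mul_pos hu hv),
      ← ENNReal.ofReal_add (by positivity) (by positivity), ← ENNReal.ofReal_mul (by positivity)]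
    convert! ENNReal.ofReal_le_ofReal
      (mul_rpow_neg_le (r := s / 2) (by linarith) (by linarith) hu hv) using 4
    ring
  refine (setLIntegral_mono' measurableSet_Ioo pointwise).trans ?_
  have hp : -1 < -(s / 2) := by linarith
  have zero_rpow : (0 : ℝ) ^ (-(s / 2) + 1) = 0 := Real.zero_rpow (by linarith)
  have hq : 1 / 2 ≤ -(s / 2) + 1 := by linarith
  rw [lintegral_const_mul' _ _ ENNReal.ofReal_ne_top, lintegral_add_left (by fun_prop),
    setLIntegral_Ioo_sub_left_rpow hp le_rfl hab.le,
    setLIntegral_Ioo_sub_right_rpow hp le_rfl hab.le, sub_self, sub_self, zero_rpow, zero_div,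
    sub_zero, ← ENNReal.ofReal_add (by positivity) (by positivity),
    ← ENNReal.ofReal_mul (by positivity)]
  refine ENNReal.ofReal_le_ofReal ?_
  have split : (b - a) ^ (1 - s) = (b - a) ^ (-(s / 2)) * (b - a) ^ (-(s / 2) + 1) := by
    rw [← Real.rpow_add hd]
    congr 1
    ring
  rw [split]
  have : (b - a) ^ (-(s / 2) + 1) / (-(s / 2) + 1) ≤ (b - a) ^ (-(s / 2) + 1) / (1 / 2) := by
    gcongr
  have : 0 < (b - a) ^ (-(s / 2)) := by positivity
  nlinarith

lemma lintegral_gapProduct_nextTriple_le (hs₀ : 0 ≤ s) (hs₁ : s ≤ 1) {x : Fin 3 → ℝ}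
    (hx : Function.Injective x) :
    ∫⁻ t, ENNReal.ofReal (gapProduct (nextTriple x t)) ^ (-(s / 2)) ∂unitCube ≤
      ENNReal.ofReal (4 * spreadMoment s) * ENNReal.ofReal (spread x) ^ (-s) :=
  lintegral_nextTriple_le_of_middle hs₀ hs₁
    (F := fun x => ENNReal.ofReal (gapProduct x) ^ (-(s / 2)))
    (measurable_gapProduct.ennreal_ofReal.pow_const _)
    (fun σ x => by rw [gapProduct_comp_perm]) zero_le_four
    (fun _ _ => setLIntegral_gapProduct_middle_le hs₀ hs₁) hx

end OneStep

/-! ### The mean of the logarithm of the area ratio -/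

lemma setLIntegral_pow_mul_neg_log (n : ℕ) :
    ∫⁻ t in Ioo (0 : ℝ) 1, ENNReal.ofReal (t ^ n * -Real.log t) =
      ENNReal.ofReal (1 / ((n + 1 : ℕ) : ℝ) ^ 2) := by
  rw [setLIntegral_Ioo_ofReal_deriv
    (g := fun t => t ^ (n + 1) / (n + 1 : ℝ) ^ 2 - t ^ n * (t * Real.log t) / (n + 1)) zero_le_one]
  · simp
  · have := Real.continuous_mul_log
    fun_prop
  · intro t ht
    have h := (((hasDerivAt_id t).pow (n + 1)).div_const ((n + 1 : ℝ) ^ 2)).sub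
      ((((hasDerivAt_id t).pow (n + 1)).mul (Real.hasDerivAt_log ht.1.ne')).div_const (n + 1 : ℝ))
    refine (h.congr_of_eventuallyEq (.of_forall fun t => ?_)).congr_deriv ?_
    · simp [pow_succ, mul_assoc]
    · have := ht.1.ne'
      simp only [Nat.cast_add, Nat.cast_one, id_eq, add_tsub_cancel_right, mul_one, Pi.pow_apply,
        mul_neg]
      field_simp
      ring
  · exact fun t ht =>
      mul_nonneg (pow_nonneg ht.1.le _) (neg_nonneg.2 (Real.log_nonpos ht.1.le ht.2.le))

lemma setLIntegral_neg_log : ∫⁻ t in Ioo (0 : ℝ) 1, ENNReal.ofReal (-Real.log t) = 1 := by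
  simpa using setLIntegral_pow_mul_neg_log 0

lemma setLIntegral_neg_log_div_one_sub :
    ∫⁻ t in Ioo (0 : ℝ) 1, ENNReal.ofReal (-Real.log t / (1 - t)) =
      ENNReal.ofReal (Real.pi ^ 2 / 6) := by
  have expand (t : ℝ) (ht : t ∈ Ioo (0 : ℝ) 1) : ENNReal.ofReal (-Real.log t / (1 - t)) =
      ∑' n : ℕ, ENNReal.ofReal (t ^ n * -Real.log t) := by
    have hlog : 0 ≤ -Real.log t := neg_nonneg.2 (Real.log_nonpos ht.1.le ht.2.le)
    have geom := (hasSum_geometric_of_lt_one ht.1.le ht.2).mul_right (-Real.log t)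
    rw [← ENNReal.ofReal_tsum_of_nonneg (fun n => mul_nonneg (pow_nonneg ht.1.le n) hlog)
      geom.summable, geom.tsum_eq, mul_comm, div_eq_mul_inv]
  have zeta := (hasSum_nat_add_iff' 1).2 hasSum_zeta_two
  rw [setLIntegral_congr_fun measurableSet_Ioo expand, lintegral_tsum fun n => by fun_prop]
  simp only [setLIntegral_pow_mul_neg_log]
  rw [← ENNReal.ofReal_tsum_of_nonneg (fun n => by positivity) zeta.summable, zeta.tsum_eq]
  simp

lemma setLIntegral_log_one_add_mul_odds {w : ℝ} (hw : 0 < w) (hw₁ : w ≠ 1) :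
    ∫⁻ a in Ioo (0 : ℝ) 1, ENNReal.ofReal (Real.log (1 + w * (a / (1 - a)))) =
      ENNReal.ofReal (w * Real.log w / (w - 1)) := by
  have hw' : w - 1 ≠ 0 := sub_ne_zero.2 hw₁
  have pos {a : ℝ} (ha : a ∈ Ioo (0 : ℝ) 1) : 0 < 1 + (w - 1) * a := by
    nlinarith [mul_pos hw ha.1, ha.2]
  rw [setLIntegral_Ioo_ofReal_deriv (g := fun a => (1 + (w - 1) * a) *
    Real.log (1 + (w - 1) * a) / (w - 1) + (1 - a) * Real.log (1 - a)) zero_le_one]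
  · simp
  · have h := Real.continuous_mul_log
    exact (((h.comp (by fun_prop : Continuous fun a : ℝ => 1 + (w - 1) * a)).div_const _).add
      (h.comp (by fun_prop : Continuous fun a : ℝ => 1 - a))).continuousOn
  · intro a ha
    have ha' : 0 < 1 - a := sub_pos.2 ha.2
    have lin := ((hasDerivAt_id a).const_mul (w - 1)).const_add 1
    have h := (((Real.hasDerivAt_mul_log (pos ha).ne').comp a lin).div_const (w - 1)).add
      ((Real.hasDerivAt_mul_log ha'.ne').comp a ((hasDerivAt_id a).const_sub 1))
    refine h.congr_deriv ?_
    rw [show 1 + w * (a / (1 - a)) = (1 + (w - 1) * a) / (1 - a) by field_simp; ring,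
      Real.log_div (pos ha).ne' ha'.ne']
    field_simp
    ring
  · intro a ha
    have : 0 < 1 - a := sub_pos.2 ha.2
    exact Real.log_nonneg (le_add_of_nonneg_right (mul_nonneg hw.le (div_nonneg ha.1.le this.le)))

lemma slope_log_nonneg {x y : ℝ} (hx : 0 < x) (hy : 0 < y) : 0 ≤ slope Real.log x y :=
  Real.strictMonoOn_log.monotoneOn.slope_nonneg hx hy

lemma setLIntegral_log_one_add_odds_mul_odds {x y : ℝ} (hx : x ∈ Ioo (0 : ℝ) 1)
    (hy : y ∈ Ioo (0 : ℝ) 1) (hxy : x ≠ y) :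
    ∫⁻ z in Ioo (0 : ℝ) 1,
        ENNReal.ofReal (Real.log (1 + x / (1 - x) * ((1 - y) / y) * (z / (1 - z)))) =
      ENNReal.ofReal (x * (1 - y) * slope Real.log x y) +
        ENNReal.ofReal (x * (1 - y) * slope Real.log (1 - x) (1 - y)) := by
  have hx' : 0 < 1 - x := sub_pos.2 hx.2
  have hy' : 0 < 1 - y := sub_pos.2 hy.2
  have := hx.1
  have := hy.1
  have hd : x - y ≠ 0 := sub_ne_zero.2 hxy
  have : y - x ≠ 0 := sub_ne_zero.2 hxy.symm
  have odds_sub_one : x / (1 - x) * ((1 - y) / y) - 1 = (x - y) / ((1 - x) * y) := by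
    field_simp
    ring
  have odds_ne : x / (1 - x) * ((1 - y) / y) ≠ 1 := by
    rw [← sub_ne_zero, odds_sub_one]
    positivity
  rw [setLIntegral_log_one_add_mul_odds (by positivity) odds_ne, odds_sub_one,
    ← ENNReal.ofReal_add (mul_nonneg (by positivity) (slope_log_nonneg hx.1 hy.1))
      (mul_nonneg (by positivity) (slope_log_nonneg hx' hy')),
    Real.log_mul (by positivity) (by positivity), Real.log_div hx.1.ne' hx'.ne',
    Real.log_div hy'.ne' hy.1.ne', slope_def_field, slope_def_field, sub_sub_sub_cancel_left]
  congr 1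
  rw [← neg_sub x y]
  field_simp
  ring

lemma measurable_slope_log : Measurable fun p : ℝ × ℝ => slope Real.log p.1 p.2 := by
  simp only [slope_def_field]
  fun_prop

lemma setLIntegral_slope_log_triangle {x : ℝ} (hx : x ∈ Ioo (0 : ℝ) 1) :
    ∫⁻ y in Ioo 0 x, ENNReal.ofReal ((x * (1 - y) + (1 - x) * y) * slope Real.log x y) =
      ∫⁻ t in Ioo (0 : ℝ) 1,
        ENNReal.ofReal (-Real.log t / (1 - t)) * ENNReal.ofReal ((1 + t) * x - 2 * t * x ^ 2) := by
  have hx₀ := hx.1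
  have scale : volume.restrict (Ioo 0 x) = ENNReal.ofReal x • uniformSegment 0 x := by
    rw [uniformSegment_of_lt hx.1, sub_zero, smul_smul, ← ENNReal.ofReal_mul hx.1.le,
      mul_inv_cancel₀ hx.1.ne', ENNReal.ofReal_one, one_smul]
  have slope_meas := measurable_slope_log
  rw [scale, lintegral_smul_measure, uniformSegment,
    lintegral_map (by fun_prop) AffineMap.lineMap_continuous.measurable, smul_eq_mul,
    ← lintegral_const_mul' _ _ ENNReal.ofReal_ne_top]
  refine setLIntegral_congr_fun measurableSet_Ioo fun t ht => ?_
  have ht' : 0 < 1 - t := sub_pos.2 ht.2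
  have : t - 1 ≠ 0 := (sub_neg.2 ht.2).ne
  have hlog : 0 ≤ -Real.log t := neg_nonneg.2 (Real.log_nonpos ht.1.le ht.2.le)
  rw [← ENNReal.ofReal_mul hx.1.le, ← ENNReal.ofReal_mul (by positivity)]
  congr 1
  rw [AffineMap.lineMap_apply_ring, slope_def_field, mul_zero, zero_add,
    Real.log_mul ht.1.ne' hx.1.ne', show t * x - x = -((1 - t) * x) by ring]
  field_simp
  ring

lemma setLIntegral_mul_sub_mul_sq {t : ℝ} (ht : t ∈ Ioo (0 : ℝ) 1) :
    ∫⁻ x in Ioo (0 : ℝ) 1, ENNReal.ofReal ((1 + t) * x - 2 * t * x ^ 2) =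
      ENNReal.ofReal (1 / 2 - t / 6) := by
  rw [setLIntegral_Ioo_ofReal_deriv
    (g := fun x => (1 + t) * x ^ 2 / 2 - 2 * t * x ^ 3 / 3) zero_le_one]
  · congr 1
    ring
  · fun_prop
  · intro x _
    have h := (((hasDerivAt_pow 2 x).const_mul (1 + t)).div_const 2).sub
      (((hasDerivAt_pow 3 x).const_mul (2 * t)).div_const 3)
    refine h.congr_deriv ?_
    push_cast
    ring
  · intro x hx
    nlinarith [mul_pos hx.1 (sub_pos.2 ht.2), mul_pos (mul_pos ht.1 hx.1) (sub_pos.2 hx.2)]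

lemma setLIntegral_slope_log :
    ∫⁻ x in Ioo (0 : ℝ) 1, ∫⁻ y in Ioo (0 : ℝ) 1,
        ENNReal.ofReal ((x * (1 - y) + (1 - x) * y) * slope Real.log x y) =
      ENNReal.ofReal (1 / 3 + Real.pi ^ 2 / 9) := by
  have slope_meas := measurable_slope_log
  rw [setLIntegral_Ioo_Ioo_eq_two_mul_lower (by unfold Function.uncurry; fun_prop)
      (fun x y => by rw [slope_comm, mul_comm x, mul_comm _ y, add_comm]) 0 1,
    setLIntegral_congr_fun measurableSet_Ioo fun x hx => setLIntegral_slope_log_triangle hx,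
    lintegral_lintegral_swap (by unfold Function.uncurry; fun_prop),
    ← lintegral_const_mul' _ _ ENNReal.ofNat_ne_top]
  have split (t : ℝ) (ht : t ∈ Ioo (0 : ℝ) 1) :
      2 * ∫⁻ x in Ioo (0 : ℝ) 1, ENNReal.ofReal (-Real.log t / (1 - t)) *
        ENNReal.ofReal ((1 + t) * x - 2 * t * x ^ 2) =
      ENNReal.ofReal (1 / 3) * ENNReal.ofReal (-Real.log t) +
        ENNReal.ofReal (2 / 3) * ENNReal.ofReal (-Real.log t / (1 - t)) := by
    have ht' : 0 < 1 - t := sub_pos.2 ht.2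
    have hlog : 0 ≤ -Real.log t := neg_nonneg.2 (Real.log_nonpos ht.1.le ht.2.le)
    rw [lintegral_const_mul' _ _ ENNReal.ofReal_ne_top, setLIntegral_mul_sub_mul_sq ht,
      ← ENNReal.ofReal_mul (by positivity), ← ENNReal.ofReal_mul (by positivity),
      ← ENNReal.ofReal_mul (by positivity), ← ENNReal.ofReal_add (by positivity) (by positivity),
      ← ENNReal.ofReal_ofNat, ← ENNReal.ofReal_mul zero_le_two]
    congr 1
    field_simp
    ring
  rw [setLIntegral_congr_fun measurableSet_Ioo split, lintegral_add_left (by fun_prop),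
    lintegral_const_mul' _ _ ENNReal.ofReal_ne_top, lintegral_const_mul' _ _ ENNReal.ofReal_ne_top,
    setLIntegral_neg_log, setLIntegral_neg_log_div_one_sub, mul_one,
    ← ENNReal.ofReal_mul (by norm_num), ← ENNReal.ofReal_add (by norm_num) (by positivity)]
  congr 1
  ring

lemma setLIntegral_log_one_add_odds :
    ∫⁻ x in Ioo (0 : ℝ) 1, ∫⁻ y in Ioo (0 : ℝ) 1, ∫⁻ z in Ioo (0 : ℝ) 1,
        ENNReal.ofReal (Real.log (1 + x / (1 - x) * (y / (1 - y)) * (z / (1 - z)))) =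
      ENNReal.ofReal (1 / 3 + Real.pi ^ 2 / 9) := by
  have slope_meas := measurable_slope_log
  have refl {f : ℝ → ℝ≥0∞} (hf : Measurable f) :
      ∫⁻ y in Ioo (0 : ℝ) 1, f y = ∫⁻ y in Ioo (0 : ℝ) 1, f (1 - y) :=
    (measurePreserving_one_sub_restrict_Ioo.lintegral_comp hf).symm
  have inner (x : ℝ) (hx : x ∈ Ioo (0 : ℝ) 1) :
      ∫⁻ y in Ioo (0 : ℝ) 1, ∫⁻ z in Ioo (0 : ℝ) 1,
          ENNReal.ofReal (Real.log (1 + x / (1 - x) * (y / (1 - y)) * (z / (1 - z)))) =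
        (∫⁻ y in Ioo (0 : ℝ) 1, ENNReal.ofReal (x * (1 - y) * slope Real.log x y)) +
          ∫⁻ y in Ioo (0 : ℝ) 1, ENNReal.ofReal (x * y * slope Real.log (1 - x) y) := by
    rw [refl (f := fun y => ENNReal.ofReal (x * y * slope Real.log (1 - x) y)) (by fun_prop),
      ← lintegral_add_left (by fun_prop), refl (by fun_prop)]
    refine lintegral_congr_ae ?_
    filter_upwards [ae_restrict_mem measurableSet_Ioo, Measure.ae_ne _ x] with y hy hyx
    rw [sub_sub_cancel, setLIntegral_log_one_add_odds_mul_odds hx hy hyx.symm]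
  rw [setLIntegral_congr_fun measurableSet_Ioo inner, lintegral_add_left (by fun_prop),
    refl (f := fun x => ∫⁻ y in Ioo (0 : ℝ) 1, ENNReal.ofReal (x * y * slope Real.log (1 - x) y))
      (by fun_prop), ← lintegral_add_left (by fun_prop), ← setLIntegral_slope_log]
  simp only [sub_sub_cancel]
  refine setLIntegral_congr_fun measurableSet_Ioo fun x hx => ?_
  rw [← lintegral_add_left (by fun_prop)]
  refine setLIntegral_congr_fun measurableSet_Ioo fun y hy => ?_
  have := hx.1
  have := hy.1
  have := sub_pos.2 hx.2
  have := sub_pos.2 hy.2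
  have := slope_log_nonneg hx.1 hy.1
  rw [← ENNReal.ofReal_add (by positivity) (by positivity), add_mul]

/-- The factor by which the area is multiplied when the vertices of a triangle are replaced by the
points that divide its sides in the proportions `t i : 1 - t i`. -/
def areaRatio (t : Fin 3 → ℝ) : ℝ := ∏ i, t i + ∏ i, (1 - t i)

lemma measurable_areaRatio : Measurable areaRatio := by
  unfold areaRatio
  fun_prop

lemma ae_unitCube_mem_Ioo : ∀ᵐ t ∂unitCube, ∀ i, t i ∈ Ioo (0 : ℝ) 1 :=
  ae_all_iff.2 fun i => (Measure.quasiMeasurePreserving_eval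
    (fun _ : Fin 3 => volume.restrict (Ioo (0 : ℝ) 1)) i).ae (ae_restrict_mem measurableSet_Ioo)

section MemIoo

variable {t : Fin 3 → ℝ} (ht : ∀ i, t i ∈ Ioo (0 : ℝ) 1)

include ht

lemma areaRatio_pos : 0 < areaRatio t :=
  add_pos (Finset.prod_pos fun i _ => (ht i).1) (Finset.prod_pos fun i _ => sub_pos.2 (ht i).2)

lemma log_areaRatio :
    Real.log (areaRatio t) =
      Real.log (1 + ∏ i, t i / (1 - t i)) + ∑ i, Real.log (1 - t i) := by
  have pos (i : Fin 3) : 0 < 1 - t i := sub_pos.2 (ht i).2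
  have odds_pos : 0 < ∏ i, t i / (1 - t i) :=
    Finset.prod_pos fun i _ => div_pos (ht i).1 (pos i)
  rw [← Real.log_prod fun i _ => (pos i).ne', ← Real.log_mul (by positivity)
    (Finset.prod_pos fun i _ => pos i).ne', add_mul, one_mul, ← Finset.prod_mul_distrib,
    areaRatio, add_comm]
  simp only [div_mul_cancel₀ _ (pos _).ne']

lemma log_one_add_prod_odds_nonneg : 0 ≤ Real.log (1 + ∏ i, t i / (1 - t i)) :=
  Real.log_nonneg (le_add_of_nonneg_right (Finset.prod_nonneg fun i _ =>
    div_nonneg (ht i).1.le (sub_nonneg.2 (ht i).2.le)))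

end MemIoo

lemma lintegral_log_one_add_prod_odds :
    ∫⁻ t, ENNReal.ofReal (Real.log (1 + ∏ i, t i / (1 - t i))) ∂unitCube =
      ENNReal.ofReal (1 / 3 + Real.pi ^ 2 / 9) := by
  rw [unitCube, lintegral_pi_fin_three _ (by fun_prop), ← setLIntegral_log_one_add_odds]
  simp only [Fin.prod_univ_three, Matrix.cons_val]

lemma aestronglyMeasurable_log_one_add_prod_odds :
    AEStronglyMeasurable (fun t : Fin 3 → ℝ => Real.log (1 + ∏ i, t i / (1 - t i))) unitCube :=
  Measurable.aestronglyMeasurable (by fun_prop)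

lemma integrable_log_one_add_prod_odds :
    Integrable (fun t => Real.log (1 + ∏ i, t i / (1 - t i))) unitCube := by
  refine ⟨aestronglyMeasurable_log_one_add_prod_odds, (hasFiniteIntegral_iff_ofReal
    (ae_unitCube_mem_Ioo.mono fun t => log_one_add_prod_odds_nonneg)).2 ?_⟩
  rw [lintegral_log_one_add_prod_odds]
  exact ENNReal.ofReal_lt_top

lemma integral_log_one_add_prod_odds :
    ∫ t, Real.log (1 + ∏ i, t i / (1 - t i)) ∂unitCube = 1 / 3 + Real.pi ^ 2 / 9 := by
  rw [integral_eq_lintegral_of_nonneg_ae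
      (ae_unitCube_mem_Ioo.mono fun t => log_one_add_prod_odds_nonneg)
      aestronglyMeasurable_log_one_add_prod_odds,
    lintegral_log_one_add_prod_odds, ENNReal.toReal_ofReal (by positivity)]

lemma integrable_log_one_sub_eval (i : Fin 3) :
    Integrable (fun t : Fin 3 → ℝ => Real.log (1 - t i)) unitCube := by
  have integrable_log : Integrable Real.log (volume.restrict (Ioo 0 1)) :=
    ((intervalIntegrable_iff_integrableOn_Ioo_of_le zero_le_one).1
      intervalIntegral.intervalIntegrable_log')
  exact integrable_comp_eval (X := fun _ => ℝ) (f := fun t : ℝ => Real.log (1 - t))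
    (measurePreserving_one_sub_restrict_Ioo.integrable_comp_of_integrable integrable_log)

lemma integral_log_one_sub_eval (i : Fin 3) : ∫ t, Real.log (1 - t i) ∂unitCube = -1 := by
  calc ∫ t, Real.log (1 - t i) ∂unitCube
      = ∫ t in Ioo (0 : ℝ) 1, Real.log (1 - t) :=
        integral_comp_eval (X := fun _ => ℝ) (f := fun t : ℝ => Real.log (1 - t))
          (Measurable.aestronglyMeasurable (by fun_prop))
    _ = ∫ t in (0 : ℝ)..1, Real.log (1 - t) := by
        rw [intervalIntegral.integral_of_le zero_le_one, integral_Ioc_eq_integral_Ioo]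
    _ = -1 := by
        rw [intervalIntegral.integral_comp_sub_left Real.log, integral_log]
        norm_num

lemma integrable_log_areaRatio : Integrable (fun t => Real.log (areaRatio t)) unitCube := by
  have h := integrable_log_one_add_prod_odds.add
    (integrable_finsetSum Finset.univ fun i _ => integrable_log_one_sub_eval i)
  exact h.congr (ae_unitCube_mem_Ioo.mono fun t ht => (log_areaRatio ht).symm)

lemma integral_log_areaRatio :
    ∫ t, Real.log (areaRatio t) ∂unitCube = Real.pi ^ 2 / 9 - 8 / 3 := by
  rw [integral_congr_ae (ae_unitCube_mem_Ioo.mono fun t ht => log_areaRatio ht),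
    integral_add integrable_log_one_add_prod_odds
      (integrable_finsetSum _ fun i _ => integrable_log_one_sub_eval i),
    integral_finsetSum _ fun i _ => integrable_log_one_sub_eval i,
    integral_log_one_add_prod_odds]
  simp only [integral_log_one_sub_eval, Finset.sum_const, Finset.card_univ, Fintype.card_fin]
  ring

/-! ### Iteration of random maps -/

section Iteration

variable {Ω : Type*} [MeasurableSpace Ω] {μ : Measure Ω}

lemma ae_tendsto_zero_of_tsum_lintegral_ne_top {f : ℕ → Ω → ℝ≥0∞} (hf : ∀ n, AEMeasurable (f n) μ)
    (hsum : ∑' n, ∫⁻ ω, f n ω ∂μ ≠ ∞) : ∀ᵐ ω ∂μ, Tendsto (fun n => f n ω) atTop (𝓝 0) := by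
  rw [← lintegral_tsum hf] at hsum
  filter_upwards [ae_lt_top' (AEMeasurable.tsum hf) hsum] with ω hω
  exact ENNReal.tendsto_atTop_zero_of_tsum_ne_top hω.ne

variable {α β : Type*} [MeasurableSpace α] [MeasurableSpace β] {ν : Measure β} {θ : ℕ → Ω → β}

/-- A sequence of random variables with common law `ν`, each of which is independent of its
predecessors. -/
structure IsIIDSeq (θ : ℕ → Ω → β) (ν : Measure β) (μ : Measure Ω) : Prop where
  hasLaw (n : ℕ) : HasLaw (θ n) ν μ
  indepFun_past (n : ℕ) : (fun ω (k : Fin n) => θ k ω) ⟂ᵢ[μ] θ n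

lemma IsIIDSeq.pairwise_indepFun (hθ : IsIIDSeq θ ν μ) : Pairwise fun m n => θ m ⟂ᵢ[μ] θ n := by
  have lt {m n : ℕ} (hmn : m < n) : θ m ⟂ᵢ[μ] θ n :=
    (hθ.indepFun_past n).comp (measurable_pi_apply (⟨m, hmn⟩ : Fin n)) measurable_id
  intro m n hmn
  exact hmn.lt_or_gt.elim lt fun h => (lt h).symm

lemma IsIIDSeq.ae_tendsto_average (hθ : IsIIDSeq θ ν μ) {g : β → ℝ} (hg : Measurable g)
    (hint : Integrable g ν) :
    ∀ᵐ ω ∂μ, Tendsto (fun n : ℕ => (∑ k ∈ Finset.range n, g (θ k ω)) / n) atTop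
      (𝓝 (∫ t, g t ∂ν)) := by
  have h := strong_law_ae_real (fun n ω => g (θ n ω))
    ((hθ.hasLaw 0).map_eq ▸ hint |>.comp_aemeasurable (hθ.hasLaw 0).aemeasurable)
    (fun m n hmn => (hθ.pairwise_indepFun hmn).comp hg hg)
    fun n => ((hθ.hasLaw n).identDistrib (hθ.hasLaw 0)).comp hg
  rwa [← (hθ.hasLaw 0).integral_comp hg.aestronglyMeasurable]

variable {f : α → β → α} {x₀ : α} {X : ℕ → Ω → α}

omit [MeasurableSpace Ω] in
lemma exists_measurable_eq_comp_past (hf : Measurable (Function.uncurry f))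
    (hX₀ : ∀ ω, X 0 ω = x₀) (hX : ∀ n ω, X (n + 1) ω = f (X n ω) (θ n ω)) (n : ℕ) :
    ∃ g : (Fin n → β) → α, Measurable g ∧ ∀ ω, X n ω = g fun k => θ k ω := by
  induction n with
  | zero => exact ⟨fun _ => x₀, measurable_const, hX₀⟩
  | succ n ih =>
    obtain ⟨g, hg, hgX⟩ := ih
    refine ⟨fun v => f (g fun k => v k.castSucc) (v (Fin.last n)), ?_, fun ω => ?_⟩
    · exact hf.comp ((hg.comp (by fun_prop)).prodMk (measurable_pi_apply _))
    · rw [hX, hgX]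
      rfl

lemma IsIIDSeq.aemeasurable_iterate (hθ : IsIIDSeq θ ν μ) (hf : Measurable (Function.uncurry f))
    (hX₀ : ∀ ω, X 0 ω = x₀) (hX : ∀ n ω, X (n + 1) ω = f (X n ω) (θ n ω)) (n : ℕ) :
    AEMeasurable (X n) μ := by
  obtain ⟨g, hg, hgX⟩ := exists_measurable_eq_comp_past hf hX₀ hX n
  rw [show X n = g ∘ fun ω k => θ k ω from funext hgX]
  exact hg.comp_aemeasurable (aemeasurable_pi_lambda _ fun k => (hθ.hasLaw k).aemeasurable)

lemma IsIIDSeq.indepFun_iterate (hθ : IsIIDSeq θ ν μ) (hf : Measurable (Function.uncurry f))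
    (hX₀ : ∀ ω, X 0 ω = x₀) (hX : ∀ n ω, X (n + 1) ω = f (X n ω) (θ n ω)) (n : ℕ) :
    X n ⟂ᵢ[μ] θ n := by
  obtain ⟨g, hg, hgX⟩ := exists_measurable_eq_comp_past hf hX₀ hX n
  rw [show X n = g ∘ fun ω k => θ k ω from funext hgX]
  exact (hθ.indepFun_past n).comp hg measurable_id

variable [IsFiniteMeasure μ] [SFinite ν]

lemma IsIIDSeq.lintegral_succ_le (hθ : IsIIDSeq θ ν μ) (hf : Measurable (Function.uncurry f))
    (hX₀ : ∀ ω, X 0 ω = x₀) (hX : ∀ n ω, X (n + 1) ω = f (X n ω) (θ n ω)) {n : ℕ} {p : α → Prop}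
    (hp : ∀ᵐ ω ∂μ, p (X n ω)) {V W : α → ℝ≥0∞} (hW : Measurable W) {C : ℝ≥0∞} (hC : C ≠ ∞)
    (step : ∀ x, p x → ∫⁻ t, W (f x t) ∂ν ≤ C * V x) :
    ∫⁻ ω, W (X (n + 1) ω) ∂μ ≤ C * ∫⁻ ω, V (X n ω) ∂μ := by
  have X_law : HasLaw (X n) (μ.map (X n)) μ := ⟨hθ.aemeasurable_iterate hf hX₀ hX n, rfl⟩
  have joint := (hθ.indepFun_iterate hf hX₀ hX n).hasLaw_prod X_law (hθ.hasLaw n)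
  have hWf : Measurable fun q : α × β => W (f q.1 q.2) := hW.comp hf
  calc ∫⁻ ω, W (X (n + 1) ω) ∂μ
      = ∫⁻ ω, W (f (X n ω) (θ n ω)) ∂μ := by simp only [hX]
    _ = ∫⁻ q, W (f q.1 q.2) ∂(μ.map (X n)).prod ν := joint.lintegral_comp hWf.aemeasurable
    _ = ∫⁻ x, ∫⁻ t, W (f x t) ∂ν ∂μ.map (X n) := lintegral_prod _ hWf.aemeasurable
    _ = ∫⁻ ω, ∫⁻ t, W (f (X n ω) t) ∂ν ∂μ :=
        (X_law.lintegral_comp hWf.lintegral_prod_right'.aemeasurable).symm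
    _ ≤ ∫⁻ ω, C * V (X n ω) ∂μ := lintegral_mono_ae (hp.mono fun ω => step _)
    _ = C * ∫⁻ ω, V (X n ω) ∂μ := lintegral_const_mul' _ _ hC

end Iteration

/-! ### Lower bound for the product of the gaps -/

lemma ofReal_spread_rpow_ne_top {x : Fin 3 → ℝ} (hx : Function.Injective x) (p : ℝ) :
    ENNReal.ofReal (spread x) ^ p ≠ ∞ :=
  ENNReal.rpow_ne_top_of_ne_zero (ENNReal.ofReal_pos.2 (spread_pos hx)).ne' ENNReal.ofReal_ne_top

lemma exp_neg_le_of_ofReal_exp_mul_rpow_lt_one {a g r : ℝ} (hr : 0 ≤ r)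
    (h : ENNReal.ofReal (Real.exp (-(a * r))) * ENNReal.ofReal g ^ (-r) < 1) :
    Real.exp (-a) ≤ g := by
  contrapose! h
  calc 1 = ENNReal.ofReal (Real.exp (-(a * r))) * ENNReal.ofReal (Real.exp (-a)) ^ (-r) := by
        rw [ENNReal.ofReal_rpow_of_pos (Real.exp_pos _), ← Real.exp_mul, neg_mul_neg,
          ← ENNReal.ofReal_mul (Real.exp_pos _).le, ← Real.exp_add, neg_add_cancel, Real.exp_zero,
          ENNReal.ofReal_one]
    _ ≤ _ := by
        rw [ENNReal.rpow_neg, ENNReal.rpow_neg]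
        gcongr

section TripleSequence

variable {Ω : Type*} [MeasurableSpace Ω] {μ : Measure Ω}
  {θ : ℕ → Ω → Fin 3 → ℝ} {x₀ : Fin 3 → ℝ} {X : ℕ → Ω → Fin 3 → ℝ}
  (hθ : IsIIDSeq θ unitCube μ) (hX₀ : ∀ ω, X 0 ω = x₀)
  (hX : ∀ n ω, X (n + 1) ω = nextTriple (X n ω) (θ n ω))

include hθ hX₀ hX

lemma aemeasurable_gapProduct_rpow (n : ℕ) (p : ℝ) :
    AEMeasurable (fun ω => ENNReal.ofReal (gapProduct (X n ω)) ^ p) μ :=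
  (measurable_gapProduct.ennreal_ofReal.pow_const p).comp_aemeasurable
    (hθ.aemeasurable_iterate measurable_nextTriple hX₀ hX n)

variable [IsProbabilityMeasure μ]

lemma lintegral_gapProduct_succ_le {s : ℝ} (hs₀ : 0 ≤ s) (hs₁ : s ≤ 1) {n : ℕ}
    (inj : ∀ᵐ ω ∂μ, Function.Injective (X n ω)) :
    ∫⁻ ω, ENNReal.ofReal (gapProduct (X (n + 1) ω)) ^ (-(s / 2)) ∂μ ≤
      ENNReal.ofReal (4 * spreadMoment s) * ∫⁻ ω, ENNReal.ofReal (spread (X n ω)) ^ (-s) ∂μ :=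
  hθ.lintegral_succ_le measurable_nextTriple hX₀ hX inj
    (measurable_gapProduct.ennreal_ofReal.pow_const _) ENNReal.ofReal_ne_top
    fun _ => lintegral_gapProduct_nextTriple_le hs₀ hs₁

lemma lintegral_spread_succ_le {s : ℝ} (hs₀ : 0 ≤ s) (hs₁ : s ≤ 1) {n : ℕ}
    (inj : ∀ᵐ ω ∂μ, Function.Injective (X n ω)) :
    ∫⁻ ω, ENNReal.ofReal (spread (X (n + 1) ω)) ^ (-s) ∂μ ≤
      ENNReal.ofReal (spreadMoment s) * ∫⁻ ω, ENNReal.ofReal (spread (X n ω)) ^ (-s) ∂μ :=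
  hθ.lintegral_succ_le measurable_nextTriple hX₀ hX inj
    (measurable_spread.ennreal_ofReal.pow_const _) ENNReal.ofReal_ne_top
    fun _ => lintegral_spread_nextTriple_le hs₀ hs₁

lemma ae_injective_succ {s : ℝ} (hs₀ : 0 < s) (hs₁ : s ≤ 1) {n : ℕ}
    (inj : ∀ᵐ ω ∂μ, Function.Injective (X n ω))
    (hfin : ∫⁻ ω, ENNReal.ofReal (spread (X n ω)) ^ (-s) ∂μ ≠ ∞) :
    ∀ᵐ ω ∂μ, Function.Injective (X (n + 1) ω) := by
  have moment_ne_top : ∫⁻ ω, ENNReal.ofReal (gapProduct (X (n + 1) ω)) ^ (-(s / 2)) ∂μ ≠ ∞ :=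
    ne_top_of_le_ne_top (ENNReal.mul_ne_top ENNReal.ofReal_ne_top hfin)
      (lintegral_gapProduct_succ_le hθ hX₀ hX hs₀.le hs₁ inj)
  have meas := aemeasurable_gapProduct_rpow hθ hX₀ hX (n + 1) (-(s / 2))
  filter_upwards [ae_lt_top' meas moment_ne_top] with ω hω
  refine injective_of_gapProduct_ne_zero fun h => hω.ne ?_
  rw [h, ENNReal.ofReal_zero, ENNReal.zero_rpow_of_neg (by linarith)]

lemma ae_injective_and_lintegral_spread_le (hx₀ : Function.Injective x₀) {s : ℝ} (hs₀ : 0 < s)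
    (hs₁ : s ≤ 1) (n : ℕ) :
    (∀ᵐ ω ∂μ, Function.Injective (X n ω)) ∧
      ∫⁻ ω, ENNReal.ofReal (spread (X n ω)) ^ (-s) ∂μ ≤
        ENNReal.ofReal (spreadMoment s) ^ n * ENNReal.ofReal (spread x₀) ^ (-s) := by
  have initial_ne_top := ofReal_spread_rpow_ne_top hx₀ (-s)
  induction n with
  | zero => exact ⟨by simpa only [hX₀] using ae_of_all μ fun _ => hx₀, by simp [hX₀]⟩
  | succ n ih =>
    obtain ⟨inj, bound⟩ := ih
    have hfin := ne_top_of_le_ne_top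
      (ENNReal.mul_ne_top (ENNReal.pow_ne_top ENNReal.ofReal_ne_top) initial_ne_top) bound
    refine ⟨ae_injective_succ hθ hX₀ hX hs₀ hs₁ inj hfin, ?_⟩
    calc ∫⁻ ω, ENNReal.ofReal (spread (X (n + 1) ω)) ^ (-s) ∂μ
        ≤ ENNReal.ofReal (spreadMoment s) * ∫⁻ ω, ENNReal.ofReal (spread (X n ω)) ^ (-s) ∂μ :=
          lintegral_spread_succ_le hθ hX₀ hX hs₀.le hs₁ inj
      _ ≤ _ := by
          rw [pow_succ', mul_assoc]
          gcongr

lemma tsum_lintegral_gapProduct_ne_top (hx₀ : Function.Injective x₀) {s : ℝ} (hs₀ : 0 < s)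
    (hs₁ : s ≤ 1) {q : ℝ≥0∞} (hq : ENNReal.ofReal (spreadMoment s) * q < 1) :
    ∑' n, ∫⁻ ω, q ^ n * ENNReal.ofReal (gapProduct (X (n + 1) ω)) ^ (-(s / 2)) ∂μ ≠ ∞ := by
  set m := ENNReal.ofReal (spreadMoment s)
  set C := ENNReal.ofReal (4 * spreadMoment s) * ENNReal.ofReal (spread x₀) ^ (-s)
  have C_ne_top : C ≠ ∞ :=
    ENNReal.mul_ne_top ENNReal.ofReal_ne_top (ofReal_spread_rpow_ne_top hx₀ _)
  have term_le (n : ℕ) : ∫⁻ ω, q ^ n * ENNReal.ofReal (gapProduct (X (n + 1) ω)) ^ (-(s / 2)) ∂μ ≤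
      C * (m * q) ^ n := by
    obtain ⟨inj, spread_le⟩ := ae_injective_and_lintegral_spread_le hθ hX₀ hX hx₀ hs₀ hs₁ n
    rw [lintegral_const_mul'' _ (aemeasurable_gapProduct_rpow hθ hX₀ hX _ _)]
    calc q ^ n * ∫⁻ ω, ENNReal.ofReal (gapProduct (X (n + 1) ω)) ^ (-(s / 2)) ∂μ
        ≤ q ^ n * (ENNReal.ofReal (4 * spreadMoment s) *
            (m ^ n * ENNReal.ofReal (spread x₀) ^ (-s))) := by
          gcongr
          exact (lintegral_gapProduct_succ_le hθ hX₀ hX hs₀.le hs₁ inj).trans (by gcongr)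
      _ = C * (m * q) ^ n := by
          rw [mul_pow]
          ring
  refine ne_top_of_le_ne_top ?_ (ENNReal.tsum_le_tsum term_le)
  rw [ENNReal.tsum_mul_left, ENNReal.tsum_geometric]
  exact ENNReal.mul_ne_top C_ne_top (ENNReal.inv_ne_top.2 (tsub_pos_of_lt hq).ne')

lemma ae_eventually_exp_le_gapProduct (hx₀ : Function.Injective x₀) {κ : ℝ}
    (hκ : 5 / 6 - Real.log 2 / 3 < κ) :
    ∀ᵐ ω ∂μ, ∀ᶠ n : ℕ in atTop, Real.exp (-(2 * κ * n)) ≤ gapProduct (X n ω) := by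
  obtain ⟨s, ⟨hs₀, hs₁⟩, hs⟩ := exists_spreadMoment_lt_exp hκ
  set q := ENNReal.ofReal (Real.exp (-(κ * s))) with hq
  have contraction : ENNReal.ofReal (spreadMoment s) * q < 1 := by
    rw [← ENNReal.ofReal_mul (spreadMoment_nonneg hs₁), ENNReal.ofReal_lt_one, Real.exp_neg,
      ← div_eq_mul_inv, div_lt_one (Real.exp_pos _)]
    exact hs
  filter_upwards [ae_tendsto_zero_of_tsum_lintegral_ne_top
    (fun n => (aemeasurable_gapProduct_rpow hθ hX₀ hX (n + 1) _).const_mul _)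
    (tsum_lintegral_gapProduct_ne_top hθ hX₀ hX hx₀ hs₀ hs₁ contraction)] with ω hω
  rw [← map_add_atTop_eq_nat 1, eventually_map]
  filter_upwards [hω.eventually_lt_const zero_lt_one] with n hn
  rw [hq, ← ENNReal.ofReal_pow (Real.exp_pos _).le, ← Real.exp_nat_mul,
    show (n : ℝ) * -(κ * s) = -(2 * κ * n * (s / 2)) by ring] at hn
  refine le_trans ?_ (exp_neg_le_of_ofReal_exp_mul_rpow_lt_one (half_pos hs₀).le hn)
  have κ_pos : 0 < κ := by linarith [Real.log_two_lt_d9]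
  gcongr
  exact n.le_succ

end TripleSequence

/-! ### Geometry of a triangle -/

section InnerProduct

open scoped RealInnerProductSpace

variable {E : Type*} [NormedAddCommGroup E] [InnerProductSpace ℝ E]

lemma exists_injective_inner {ι : Type*} [Finite ι] {T : ι → E} (hT : Function.Injective T) :
    ∃ e : E, Function.Injective fun i => ⟪e, T i⟫ := by
  obtain ⟨e, he⟩ := Module.Dual.exists_forall_ne_zero_of_forall_exists
    (fun p : {p : ι × ι // p.1 ≠ p.2} => (innerₛₗ ℝ (T p.1.1 - T p.1.2)))
    fun p => ⟨_, inner_self_ne_zero.2 (sub_ne_zero.2 (hT.ne p.2))⟩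
  refine ⟨e, fun i j hij => ?_⟩
  by_contra h
  refine he ⟨(i, j), h⟩ ?_
  rw [innerₛₗ_apply_apply, real_inner_comm, inner_sub_right]
  exact sub_eq_zero.2 hij

-- Cauchy-Schwarz for `w` and the mirror image of `v` in the line spanned by `e`.
lemma sq_norm_mul_inner_sub_le (e v w : E) :
    ‖e‖ ^ 2 * ⟪v, w⟫ - 2 * (⟪e, v⟫ * ⟪e, w⟫) ≤ ‖e‖ ^ 2 * (‖v‖ * ‖w‖) := by
  rcases eq_or_ne e 0 with rfl | he
  · simp
  have norm_pos : 0 < ‖e‖ := norm_pos_iff.2 he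
  have inner_reflection : ⟪(ℝ ∙ e).reflection v, w⟫ = 2 * (⟪e, v⟫ / ‖e‖ ^ 2 * ⟪e, w⟫) - ⟪v, w⟫ := by
    rw [Submodule.reflection_singleton_apply, inner_sub_left, two_smul, inner_add_left,
      real_inner_smul_left, ← two_mul]
    rfl
  have cauchy_schwarz := neg_le_of_abs_le (abs_real_inner_le_norm ((ℝ ∙ e).reflection v) w)
  rw [LinearIsometryEquiv.norm_map, inner_reflection] at cauchy_schwarz
  have := mul_le_mul_of_nonneg_left cauchy_schwarz (sq_nonneg ‖e‖)
  field_simp at this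
  linarith

lemma pi_sub_mul_one_sub_cos_le {θ : ℝ} (hθ₀ : 0 ≤ θ) (hθ₁ : θ ≤ Real.pi) :
    (Real.pi - θ) * (1 - Real.cos θ) ≤ 2 * Real.sin θ := by
  set φ := (Real.pi - θ) / 2 with hφ
  have hθ : θ = Real.pi - 2 * φ := by ring
  have key : φ * Real.cos φ ≤ Real.sin φ := by
    rcases hθ₀.eq_or_lt with rfl | h
    · simp [hφ]
    · have hcos : 0 < Real.cos φ := Real.cos_pos_of_mem_Ioo ⟨by linarith, by linarith⟩
      rw [← le_div_iff₀ hcos, ← Real.tan_eq_sin_div_cos]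
      exact Real.le_tan (by linarith) (by linarith)
  have hcos : 0 ≤ Real.cos φ := Real.cos_nonneg_of_mem_Icc ⟨by linarith, by linarith⟩
  rw [hθ, Real.sin_pi_sub, Real.cos_pi_sub, Real.sin_two_mul, Real.cos_two_mul]
  nlinarith [mul_le_mul_of_nonneg_right key hcos]

lemma pi_sub_angle_le {e v w : E} (h : 0 < -(⟪e, v⟫ * ⟪e, w⟫)) :
    Real.pi - InnerProductGeometry.angle v w ≤
      ‖e‖ ^ 2 * (Real.sin (InnerProductGeometry.angle v w) * (‖v‖ * ‖w‖)) /
        -(⟪e, v⟫ * ⟪e, w⟫) := by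
  set θ := InnerProductGeometry.angle v w
  have half_angle : (Real.pi - θ) * (1 - Real.cos θ) ≤ 2 * Real.sin θ :=
    pi_sub_mul_one_sub_cos_le (InnerProductGeometry.angle_nonneg v w)
      (InnerProductGeometry.angle_le_pi v w)
  have inner_bound : 2 * -(⟪e, v⟫ * ⟪e, w⟫) ≤ ‖e‖ ^ 2 * (‖v‖ * ‖w‖) * (1 - Real.cos θ) := by
    have := sq_norm_mul_inner_sub_le e v w
    rw [← InnerProductGeometry.cos_angle_mul_norm_mul_norm] at this
    linarith
  rw [le_div_iff₀ h]
  have hθ : 0 ≤ Real.pi - θ := sub_nonneg.2 (InnerProductGeometry.angle_le_pi v w)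
  have h₁ := mul_le_mul_of_nonneg_left inner_bound hθ
  have h₂ := mul_le_mul_of_nonneg_left half_angle (by positivity : 0 ≤ ‖e‖ ^ 2 * (‖v‖ * ‖w‖))
  linarith

lemma norm_sub_cos_angle_smul (v w : E) :
    ‖v - (Real.cos (InnerProductGeometry.angle v w) * ‖v‖ / ‖w‖) • w‖ =
      Real.sin (InnerProductGeometry.angle v w) * ‖v‖ := by
  have sin_nonneg := InnerProductGeometry.sin_angle_nonneg v w
  rw [← sq_eq_sq₀ (norm_nonneg _) (by positivity), norm_sub_sq_real, real_inner_smul_right,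
    norm_smul, mul_pow, mul_pow, Real.norm_eq_abs, sq_abs,
    ← InnerProductGeometry.cos_angle_mul_norm_mul_norm, Real.sin_sq]
  rcases eq_or_ne w 0 with rfl | hw
  · simp
  · have : ‖w‖ ≠ 0 := norm_ne_zero_iff.2 hw
    field_simp
    ring

lemma infDist_affineSpan_pair_le (p q r : E) :
    Metric.infDist p (line[ℝ, q, r] : Set E) ≤
      Real.sin (EuclideanGeometry.angle p q r) * dist p q := by
  refine (Metric.infDist_le_dist_of_mem (AffineMap.lineMap_mem_affineSpan_pair
    (Real.cos (EuclideanGeometry.angle p q r) * ‖p - q‖ / ‖r - q‖) q r)).trans_eq ?_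
  rw [dist_eq_norm, dist_eq_norm, AffineMap.lineMap_apply, vsub_eq_sub, vadd_eq_add, add_comm,
    ← sub_sub]
  exact norm_sub_cos_angle_smul (p - q) (r - q)

end InnerProduct

section Triangle

open scoped RealInnerProductSpace

/-- Twice the signed area of a triangle. -/
def twiceSignedArea (T : Tri) : ℝ :=
  (T 1 0 - T 0 0) * (T 2 1 - T 0 1) - (T 1 1 - T 0 1) * (T 2 0 - T 0 0)

/-- The coordinates of the vertices of a triangle along `e`, up to the factor `‖e‖`. -/
noncomputable def coordsAlong (e : Plane) (T : Tri) : Fin 3 → ℝ := fun i => ⟪e, T i⟫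

lemma coordsAlong_subTriangle (e : Plane) (T : Tri) (t : Fin 3 → ℝ) :
    coordsAlong e (subTriangle T t) = nextTriple (coordsAlong e T) t :=
  funext fun _ => (innerₛₗ ℝ e).toAffineMap.apply_lineMap _ _ _

lemma twiceSignedArea_subTriangle (T : Tri) (t : Fin 3 → ℝ) :
    twiceSignedArea (subTriangle T t) = areaRatio t * twiceSignedArea T := by
  have apply (i : Fin 3) (j : Fin 2) :
      subTriangle T t i j = T (i + 1) j + t i * (T (i + 2) j - T (i + 1) j) := by
    simp [subTriangle, AffineMap.lineMap_apply, add_comm]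
  simp only [twiceSignedArea, areaRatio, apply, Fin.prod_univ_three, Fin.isValue, zero_add,
    Fin.reduceAdd]
  ring

lemma affineIndependent_iff_twiceSignedArea_ne_zero {T : Tri} :
    AffineIndependent ℝ T ↔ twiceSignedArea T ≠ 0 := by
  have rows : (WithLp.linearEquiv 2 ℝ (Fin 2 → ℝ)) ∘ (fun i : {x : Fin 3 // x ≠ 0} =>
      (T i -ᵥ T 0 : Plane)) ∘ finSuccAboveEquiv (0 : Fin 3) =
      Matrix.row !![T 1 0 - T 0 0, T 1 1 - T 0 1; T 2 0 - T 0 0, T 2 1 - T 0 1] := by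
    ext i j
    fin_cases i <;> fin_cases j <;> rfl
  rw [affineIndependent_iff_linearIndependent_vsub ℝ T 0,
    ← linearIndependent_equiv (finSuccAboveEquiv (0 : Fin 3)),
    ← LinearMap.linearIndependent_iff (WithLp.linearEquiv 2 ℝ (Fin 2 → ℝ)).toLinearMap
      (LinearEquiv.ker _), LinearEquiv.coe_coe, rows, Matrix.linearIndependent_rows_iff_isUnit,
    Matrix.isUnit_iff_isUnit_det, Matrix.det_fin_two_of, isUnit_iff_ne_zero, twiceSignedArea]

lemma twiceSignedArea_rotate (T : Tri) (i : Fin 3) :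
    twiceSignedArea (fun j => T (i + j)) = twiceSignedArea T := by
  fin_cases i <;> simp [twiceSignedArea] <;> ring

lemma sin_angle_mul_dist_mul_dist (T : Tri) (i : Fin 3) :
    Real.sin (EuclideanGeometry.angle (T (i + 1)) (T i) (T (i + 2))) *
      (dist (T (i + 1)) (T i) * dist (T (i + 2)) (T i)) = |twiceSignedArea T| := by
  rw [EuclideanGeometry.angle, dist_eq_norm_vsub, dist_eq_norm_vsub,
    InnerProductGeometry.sin_angle_mul_norm_mul_norm, ← twiceSignedArea_rotate T i,
    ← Real.sqrt_sq_eq_abs]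
  congr 1
  simp only [EuclideanSpace.inner_eq_star_dotProduct]
  simp only [vsub_eq_sub, WithLp.ofLp_sub, star_trivial, dotProduct_sub, sub_dotProduct,
    Matrix.vec2_dotProduct, twiceSignedArea, add_zero]
  ring

lemma height_mul_side_le (T : Tri) (i : Fin 3) : height T i * side T i ≤ |twiceSignedArea T| := by
  calc height T i * side T i
      ≤ Real.sin (EuclideanGeometry.angle (T i) (T (i + 1)) (T (i + 2))) * dist (T i) (T (i + 1)) *
          side T i := by
        gcongr
        · exact dist_nonneg
        · exact infDist_affineSpan_pair_le _ _ _
    _ = |twiceSignedArea T| := by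
        have add_one_add_one : i + 1 + 1 = i + 2 := add_assoc i 1 1
        have add_one_add_two : i + 1 + 2 = i := (add_assoc i 1 2).trans (add_zero i)
        rw [← sin_angle_mul_dist_mul_dist T (i + 1), add_one_add_one, add_one_add_two, side,
          EuclideanGeometry.angle_comm, dist_comm (T (i + 1)) (T (i + 2))]
        ring

lemma abs_coordsAlong_sub_le (e : Plane) (T : Tri) (i j : Fin 3) :
    |coordsAlong e T i - coordsAlong e T j| ≤ ‖e‖ * dist (T i) (T j) := by
  rw [coordsAlong, coordsAlong, ← inner_sub_right, dist_eq_norm]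
  exact abs_real_inner_le_norm _ _

lemma exists_gapProduct_eq {x : Fin 3 → ℝ} (hx : Function.Injective x) :
    ∃ i, gapProduct x = -((x (i + 1) - x i) * (x (i + 2) - x i)) := by
  obtain ⟨σ, l, m, h, hlm, hmh, hσ⟩ := exists_perm_comp_eq_of_injective hx
  have h₀ : x (σ 0) = l := congrFun hσ 0
  have h₁ : x (σ 1) = m := congrFun hσ 1
  have h₂ : x (σ 2) = h := congrFun hσ 2
  have one_add_one : (1 + 1 : Fin 3) = 2 := rfl
  have one_add_two : (1 + 2 : Fin 3) = 0 := rfl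
  refine ⟨σ 1, ?_⟩
  rw [← gapProduct_comp_perm x σ, hσ, gapProduct_sorted hlm hmh, ← h₀, ← h₁, ← h₂]
  rcases perm_opposite σ 1 with ⟨h₃, h₄⟩ | ⟨h₃, h₄⟩
  · rw [← h₃, ← h₄, one_add_one, one_add_two]
    ring
  · rw [← h₃, ← h₄, one_add_one, one_add_two]
    ring

lemma height_div_side_le {e : Plane} {T : Tri} (hG : 0 < gapProduct (coordsAlong e T)) {i : Fin 3}
    (hi : IsLargestSide T i) :
    height T i / side T i ≤ ‖e‖ ^ 2 * |twiceSignedArea T| / gapProduct (coordsAlong e T) := by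
  set x := coordsAlong e T
  have spread_le : spread x ≤ 3 / 2 * (‖e‖ * side T i) := by
    have (j : Fin 3) : |x (j + 1) - x (j + 2)| ≤ ‖e‖ * side T i :=
      (abs_coordsAlong_sub_le e T _ _).trans (by gcongr; exact hi j)
    have := Finset.sum_le_card_nsmul Finset.univ _ _ fun j _ => this j
    simp only [Finset.card_univ, Fintype.card_fin, nsmul_eq_mul, Nat.cast_ofNat] at this
    rw [spread]
    linarith
  have inj : Function.Injective x := injective_of_gapProduct_ne_zero hG.ne'
  have gapProduct_le : gapProduct x ≤ ‖e‖ ^ 2 * side T i ^ 2 := by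
    have := four_mul_gapProduct_le_spread_sq inj
    have := pow_le_pow_left₀ (spread_nonneg x) spread_le 2
    nlinarith [sq_nonneg (‖e‖ * side T i)]
  have side_pos : 0 < side T i := by
    refine dist_nonneg.lt_of_ne fun h : 0 = side T i => hG.not_ge ?_
    simpa [← h] using gapProduct_le
  rw [div_le_div_iff₀ side_pos hG]
  calc height T i * gapProduct x ≤ height T i * (‖e‖ ^ 2 * side T i ^ 2) := by
        gcongr
        exact Metric.infDist_nonneg
    _ = ‖e‖ ^ 2 * (height T i * side T i) * side T i := by ring
    _ ≤ ‖e‖ ^ 2 * |twiceSignedArea T| * side T i := by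
        gcongr
        exact height_mul_side_le T i

lemma maxAngle_le_pi (T : Tri) : maxAngle T ≤ Real.pi :=
  ciSup_le fun _ => EuclideanGeometry.angle_le_pi _ _ _

lemma pi_sub_le_maxAngle {e : Plane} {T : Tri} (hG : 0 < gapProduct (coordsAlong e T)) :
    Real.pi - ‖e‖ ^ 2 * |twiceSignedArea T| / gapProduct (coordsAlong e T) ≤ maxAngle T := by
  obtain ⟨i, hi⟩ := exists_gapProduct_eq (injective_of_gapProduct_ne_zero hG.ne')
  have gap_eq : gapProduct (coordsAlong e T) =
      -(⟪e, T (i + 1) -ᵥ T i⟫ * ⟪e, T (i + 2) -ᵥ T i⟫) := by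
    rw [hi]
    simp only [coordsAlong, vsub_eq_sub, inner_sub_right]
  have angle_bound := pi_sub_angle_le (gap_eq ▸ hG)
  rw [← gap_eq, ← dist_eq_norm_vsub, ← dist_eq_norm_vsub] at angle_bound
  calc _ ≤ EuclideanGeometry.angle (T (i + 1)) (T i) (T (i + 2)) := by
        rw [← sin_angle_mul_dist_mul_dist T i]
        exact sub_le_comm.1 angle_bound
    _ ≤ maxAngle T := le_ciSup (f := fun i => EuclideanGeometry.angle (T (i + 1)) (T i) (T (i + 2)))
        (Set.finite_range _).bddAbove i

end Triangle

/-! ### Almost sure asymptotics -/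

lemma twiceSignedArea_triangleSeq (T₀ : Tri) (t : ℕ → Fin 3 → ℝ) (n : ℕ) :
    twiceSignedArea (triangleSeq T₀ t n) =
      (∏ k ∈ Finset.range n, areaRatio (t k)) * twiceSignedArea T₀ := by
  induction n with
  | zero => rw [triangleSeq, Finset.prod_range_zero, one_mul]
  | succ n ih =>
    rw [triangleSeq, twiceSignedArea_subTriangle, ih, Finset.prod_range_succ_comm, mul_assoc]

lemma affineIndependent_triangleSeq {T₀ : Tri} (hT₀ : AffineIndependent ℝ T₀)
    {t : ℕ → Fin 3 → ℝ} (ht : ∀ k i, t k i ∈ Ioo (0 : ℝ) 1) (n : ℕ) :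
    AffineIndependent ℝ (triangleSeq T₀ t n) := by
  rw [affineIndependent_iff_twiceSignedArea_ne_zero] at hT₀ ⊢
  rw [twiceSignedArea_triangleSeq]
  exact mul_ne_zero (Finset.prod_ne_zero_iff.2 fun k _ => (areaRatio_pos (ht k)).ne') hT₀

lemma eventually_mul_exp_le (K : ℝ) {a b : ℝ} (hab : a < b) :
    ∀ᶠ n : ℕ in atTop, K * Real.exp (a * n) ≤ Real.exp (b * n) := by
  have growth : Tendsto (fun n : ℕ => Real.exp ((b - a) * n)) atTop atTop :=
    Real.tendsto_exp_atTop.comp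
      (tendsto_natCast_atTop_atTop.const_mul_atTop (sub_pos.2 hab))
  filter_upwards [growth.eventually_ge_atTop K] with n hn
  calc K * Real.exp (a * n) ≤ Real.exp ((b - a) * n) * Real.exp (a * n) := by gcongr
    _ = Real.exp (b * n) := by rw [← Real.exp_add]; congr 1; ring

lemma log_four : Real.log 4 = 2 * Real.log 2 := by
  rw [show (4 : ℝ) = 2 ^ 2 by norm_num, Real.log_pow, Nat.cast_ofNat]

lemma rate_bounds : 0.365 < 1 + Real.log 4 / 3 - Real.pi ^ 2 / 9 ∧
    1 + Real.log 4 / 3 - Real.pi ^ 2 / 9 < 0.366 := by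
  rw [log_four]
  constructor <;>
    nlinarith [Real.log_two_gt_d9, Real.log_two_lt_d9, Real.pi_gt_d4, Real.pi_lt_d4]

variable {Ω : Type*} [MeasurableSpace Ω] {μ : Measure Ω}

section IIDParameters

variable {θ : ℕ → Ω → Fin 3 → ℝ} (hθ : IsIIDSeq θ unitCube μ)

include hθ

lemma ae_mem_Ioo : ∀ᵐ ω ∂μ, ∀ n i, θ n ω i ∈ Ioo (0 : ℝ) 1 :=
  ae_all_iff.2 fun n => ((hθ.hasLaw n).ae_iff (p := fun t => ∀ i, t i ∈ Ioo (0 : ℝ) 1)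
    (.forall fun i => measurableSet_Ioo.mem.comp (measurable_pi_apply i))).2 ae_unitCube_mem_Ioo

lemma ae_eventually_prod_areaRatio_le {a : ℝ} (ha : Real.pi ^ 2 / 9 - 8 / 3 < a) :
    ∀ᵐ ω ∂μ, ∀ᶠ n : ℕ in atTop,
      ∏ k ∈ Finset.range n, areaRatio (θ k ω) ≤ Real.exp (a * n) := by
  filter_upwards [ae_mem_Ioo hθ, hθ.ae_tendsto_average
    (Real.measurable_log.comp measurable_areaRatio) integrable_log_areaRatio] with ω mem average
  simp only [Function.comp_apply] at average
  rw [integral_log_areaRatio] at average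
  filter_upwards [average.eventually_lt_const ha, eventually_gt_atTop 0] with n hn n_pos
  rw [div_lt_iff₀ (by exact_mod_cast n_pos)] at hn
  rw [← Real.log_prod fun k _ => (areaRatio_pos (mem k)).ne'] at hn
  exact (Real.log_le_iff_le_exp (Finset.prod_pos fun k _ => areaRatio_pos (mem k))).1 hn.le

variable [IsProbabilityMeasure μ]

lemma ae_eventually_area_div_gapProduct_le {T₀ : Tri} {e : Plane}
    (he : Function.Injective (coordsAlong e T₀)) {c : ℝ}
    (hc : c < 1 + Real.log 4 / 3 - Real.pi ^ 2 / 9) :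
    ∀ᵐ ω ∂μ, ∀ᶠ n : ℕ in atTop,
      0 < gapProduct (coordsAlong e (triangleSeq T₀ (fun k => θ k ω) n)) ∧
      ‖e‖ ^ 2 * |twiceSignedArea (triangleSeq T₀ (fun k => θ k ω) n)| /
        gapProduct (coordsAlong e (triangleSeq T₀ (fun k => θ k ω) n)) ≤ Real.exp (-c * n) := by
  set ε := (1 + Real.log 4 / 3 - Real.pi ^ 2 / 9 - c) / 4 with hε
  set a := Real.pi ^ 2 / 9 - 8 / 3 + ε with ha
  set κ := 5 / 6 - Real.log 2 / 3 + ε with hκ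
  have ε_pos : 0 < ε := div_pos (sub_pos.2 hc) four_pos
  have rate : a + 2 * κ < -c := by linarith [log_four]
  filter_upwards [ae_mem_Ioo hθ, ae_eventually_prod_areaRatio_le hθ (lt_add_of_pos_right _ ε_pos),
    ae_eventually_exp_le_gapProduct hθ
      (X := fun n ω => coordsAlong e (triangleSeq T₀ (fun k => θ k ω) n)) (fun _ => rfl)
      (fun n ω => coordsAlong_subTriangle e (triangleSeq T₀ (fun k => θ k ω) n) (θ n ω)) he
      (lt_add_of_pos_right _ ε_pos)] with ω mem area_le gapProduct_ge
  filter_upwards [area_le, gapProduct_ge,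
    eventually_mul_exp_le (‖e‖ ^ 2 * |twiceSignedArea T₀|) rate] with n area_le gapProduct_ge decay
  have gapProduct_pos := (Real.exp_pos _).trans_le gapProduct_ge
  refine ⟨gapProduct_pos, ?_⟩
  rw [div_le_iff₀ gapProduct_pos, twiceSignedArea_triangleSeq, abs_mul,
    abs_of_pos (Finset.prod_pos fun k _ => areaRatio_pos (mem k))]
  calc ‖e‖ ^ 2 * ((∏ k ∈ Finset.range n, areaRatio (θ k ω)) * |twiceSignedArea T₀|)
      ≤ ‖e‖ ^ 2 * (Real.exp (a * n) * |twiceSignedArea T₀|) := by gcongr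
    _ = ‖e‖ ^ 2 * |twiceSignedArea T₀| * Real.exp ((a + 2 * κ) * n) * Real.exp (-(2 * κ * n)) := by
        rw [mul_assoc (‖e‖ ^ 2 * _), ← Real.exp_add]
        ring_nf
    _ ≤ Real.exp (-c * n) * gapProduct (coordsAlong e (triangleSeq T₀ (fun k => θ k ω) n)) := by
        gcongr

lemma ae_eventually_height_div_side_le {T₀ : Tri} (hT₀ : AffineIndependent ℝ T₀) {c : ℝ}
    (hc : c < 1 + Real.log 4 / 3 - Real.pi ^ 2 / 9) :
    ∀ᵐ ω ∂μ, ∀ᶠ n : ℕ in atTop, ∀ i, IsLargestSide (triangleSeq T₀ (fun k => θ k ω) n) i →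
      height (triangleSeq T₀ (fun k => θ k ω) n) i / side (triangleSeq T₀ (fun k => θ k ω) n) i ≤
        Real.exp (-c * n) := by
  obtain ⟨e, he⟩ := exists_injective_inner hT₀.injective
  filter_upwards [ae_eventually_area_div_gapProduct_le hθ he hc] with ω decay
  filter_upwards [decay] with n hn i hi
  exact (height_div_side_le hn.1 hi).trans hn.2

lemma ae_tendsto_maxAngle {T₀ : Tri} (hT₀ : AffineIndependent ℝ T₀) :
    ∀ᵐ ω ∂μ, Tendsto (fun n => maxAngle (triangleSeq T₀ (fun k => θ k ω) n)) atTop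
      (𝓝 Real.pi) := by
  obtain ⟨e, he⟩ := exists_injective_inner hT₀.injective
  have exp_tendsto : Tendsto (fun n : ℕ => Real.exp (-0.365 * n)) atTop (𝓝 0) :=
    Real.tendsto_exp_atBot.comp
      (tendsto_natCast_atTop_atTop.const_mul_atTop_of_neg (by norm_num))
  filter_upwards [ae_eventually_area_div_gapProduct_le hθ he rate_bounds.1] with ω decay
  have lower_tendsto :
      Tendsto (fun n : ℕ => Real.pi - Real.exp (-0.365 * n)) atTop (𝓝 Real.pi) := by
    simpa only [sub_zero] using exp_tendsto.const_sub Real.pi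
  refine tendsto_of_tendsto_of_tendsto_of_le_of_le' lower_tendsto tendsto_const_nhds ?_
    (.of_forall fun n => maxAngle_le_pi _)
  filter_upwards [decay] with n hn
  exact (sub_le_sub_left hn.2 _).trans (pi_sub_le_maxAngle hn.1)

end IIDParameters

section UniformParameters

variable {ξ : ℕ → Fin 3 → Ω → ℝ}

lemma hasLaw_of_isUniform {Y : Ω → ℝ} (h : pdf.IsUniform Y (Icc 0 1) μ volume) :
    HasLaw Y (volume.restrict (Ioo 0 1)) μ where
  aemeasurable := h.aemeasurable (by simp) (by simp)
  map_eq := by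
    have h' : μ.map Y = ProbabilityTheory.cond volume (Icc 0 1) := h
    rw [h', ProbabilityTheory.cond, Real.volume_Icc, sub_zero, ENNReal.ofReal_one, inv_one,
      one_smul, Measure.restrict_congr_set Ioo_ae_eq_Icc]

lemma isIIDSeq_of_isUniform (hξ_indep : iIndepFun (fun p : ℕ × Fin 3 => ξ p.1 p.2) μ)
    (hξ_unif : ∀ n i, pdf.IsUniform (ξ n i) (Icc 0 1) μ volume) :
    IsIIDSeq (fun n ω i => ξ n i ω) unitCube μ where
  hasLaw n :=
    (hξ_indep.precomp (Prod.mk_right_injective n)).hasLaw_pi fun i =>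
      hasLaw_of_isUniform (hξ_unif n i)
  indepFun_past n := by
    classical
    have disjoint : Disjoint (Finset.range n ×ˢ (Finset.univ : Finset (Fin 3)))
        ({n} ×ˢ (Finset.univ : Finset (Fin 3))) :=
      Finset.disjoint_product.2 (.inl (by simp))
    have indep := hξ_indep.indepFun_finset₀ _ _ disjoint
      fun p => (hasLaw_of_isUniform (hξ_unif p.1 p.2)).aemeasurable
    have past_mem (k : Fin n) (i : Fin 3) :
        ((k : ℕ), i) ∈ Finset.range n ×ˢ (Finset.univ : Finset (Fin 3)) := by simp
    have present_mem (i : Fin 3) : (n, i) ∈ {n} ×ˢ (Finset.univ : Finset (Fin 3)) := by simp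
    exact indep.comp (φ := fun v (k : Fin n) i => v ⟨_, past_mem k i⟩)
      (ψ := fun v i => v ⟨_, present_mem i⟩) (by fun_prop) (by fun_prop)

end UniformParameters

end RandomTriangle

theorem theorem4 {Ω : Type*} [MeasurableSpace Ω] (μ : MeasureTheory.Measure Ω)
    [MeasureTheory.IsProbabilityMeasure μ]
    (ξ : ℕ → Fin 3 → Ω → ℝ)
    (hξ_indep : ProbabilityTheory.iIndepFun (fun p : ℕ × Fin 3 => ξ p.1 p.2) μ)
    (hξ_unif : ∀ n i, MeasureTheory.pdf.IsUniform (ξ n i) (Set.Icc 0 1) μ MeasureTheory.volume)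
    (T₀ : RandomTriangle.Tri) (hT₀ : AffineIndependent ℝ T₀)
    (T : ℕ → Ω → RandomTriangle.Tri)
    (hT : ∀ n ω, T n ω = RandomTriangle.triangleSeq T₀ (fun k i => ξ k i ω) n) :
    (∀ᵐ ω ∂μ, ∀ n, AffineIndependent ℝ (T n ω)) ∧
    (∀ᵐ ω ∂μ, Filter.Tendsto (fun n => RandomTriangle.maxAngle (T n ω)) Filter.atTop
      (nhds Real.pi)) ∧
    (∀ c : ℝ, c < 1 + Real.log 4 / 3 - Real.pi ^ 2 / 9 →
      ∀ᵐ ω ∂μ, ∀ᶠ n : ℕ in Filter.atTop, ∀ i, RandomTriangle.IsLargestSide (T n ω) i →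
        RandomTriangle.height (T n ω) i / RandomTriangle.side (T n ω) i
          ≤ Real.exp (-c * n)) ∧
    0.365 < 1 + Real.log 4 / 3 - Real.pi ^ 2 / 9 ∧
    1 + Real.log 4 / 3 - Real.pi ^ 2 / 9 < 0.366 := by
  obtain rfl : T = fun n ω => RandomTriangle.triangleSeq T₀ (fun k i => ξ k i ω) n :=
    funext fun n => funext fun ω => hT n ω
  have hθ := RandomTriangle.isIIDSeq_of_isUniform hξ_indep hξ_unif
  refine ⟨?_, RandomTriangle.ae_tendsto_maxAngle hθ hT₀,
    fun c hc => RandomTriangle.ae_eventually_height_div_side_le hθ hT₀ hc,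
    RandomTriangle.rate_bounds⟩
  filter_upwards [RandomTriangle.ae_mem_Ioo hθ] with ω hω
  exact RandomTriangle.affineIndependent_triangleSeq hT₀ hω
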